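/- Let $(\Omega,\mathcal S,\mu)$ be a non-atomic Lebesgue probability space (that is, isomorphic modulo null sets to $[0,1]$ with Lebesgue measure), and let $T\colon\Omega\to\Omega$ be an ergodic automorphism of it (a bijection, measurable with measurable inverse, preserving $\mu$ and ergodic). Let $X$ be a Polish space and $\eta$ a Borel probability measure on $X$. Let $c\colon X\times X\to[0,\infty)$ be a symmetric cost function, that is, an upper semicontinuous function with $c(x,x)=0$ and $c(y,x)=c(x,y)$ for all $x,y\in X$. Let $b>0$, and suppose that $c$ fits the budget $b$ with respect to $\eta$, that is, for any two Borel sets $A,B\subseteq X$ with $\eta(A)>0$, $\eta(B)>0$ and $\eta(A\cup B)=1$ we have $$\inf_{x\in A,\ y\in B} c(x,y)<b.$$ Then there exists a measurable function $f\colon\Omega\to X$ such that $f_*\mu=\eta$ and $$c(f(\omega),f(T\omega))<b\quad\text{for every }\omega\in\Omega.$$ -/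

import Mathlib

open MeasureTheory

/-- Two measure spaces are isomorphic modulo null sets: after deleting a measurable null set from
each of them there is a bimeasurable, measure-preserving bijection. -/
def IsIsomorphicModZero {α β : Type*} [MeasurableSpace α] [MeasurableSpace β]
    (μ : Measure α) (ν : Measure β) : Prop :=
  ∃ (s : Set α) (t : Set β), MeasurableSet s ∧ MeasurableSet t ∧ μ sᶜ = 0 ∧ ν tᶜ = 0 ∧
    ∃ e : s ≃ᵐ t,
      MeasurePreserving e (μ.comap (Subtype.val : s → α)) (ν.comap (Subtype.val : t → β))

/-- A non-atomic Lebesgue probability space: its completion is isomorphic modulo null sets to the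
unit interval with the Lebesgue σ-algebra and Lebesgue measure.  When the σ-algebra of `Ω` is
already complete, the completion of `μ` is `μ` itself, and this is the classical definition; a
σ-algebra that is not complete (such as the Borel σ-algebra of a Polish space) is allowed too. -/
def IsNonatomicLebesgueSpace {Ω : Type*} [MeasurableSpace Ω] (μ : Measure Ω) : Prop :=
  IsIsomorphicModZero μ.completion (volume : Measure unitInterval).completion

/-- A cost function on a topological space: a nonnegative upper semicontinuous function of pairs
of points that vanishes on the diagonal. -/
structure IsCostFunction {X : Type*} [TopologicalSpace X] (c : X × X → ℝ) : Prop where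
  nonneg : ∀ p, 0 ≤ c p
  upperSemicontinuous : UpperSemicontinuous c
  diag : ∀ x, c (x, x) = 0

/-- A cost function that is moreover symmetric. -/
structure IsSymmetricCostFunction {X : Type*} [TopologicalSpace X] (c : X × X → ℝ) : Prop
    extends IsCostFunction c where
  symm : ∀ x y, c (y, x) = c (x, y)

/-- The function `c` fits the budget `b` with respect to `η`.  The infimum is taken over a
nonempty set, since `A` and `B` have positive measure, and it is bounded below by `0` when `c` is
a cost function. -/
def FitsBudget {X : Type*} [MeasurableSpace X] (c : X × X → ℝ) (η : Measure X) (b : ℝ) : Prop :=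
  ∀ A B : Set X, MeasurableSet A → MeasurableSet B → 0 < η A → 0 < η B → η (A ∪ B) = 1 →
    sInf (c '' (A ×ˢ B)) < b

/-! Upper semicontinuity makes `{c < b}` an open neighbourhood of the diagonal. Countably many basic
open sets `O v` of positive measure, each with `O v ×ˢ O v` inside `{c < b}`, cover `X` up to a null
set. Join `v` and `w` when `O v ×ˢ O w` lies in `{c < b}`. The budget condition says exactly what is
needed for this reflexive symmetric graph to be connected (`FitsBudget.exists_connected_cover`).
Split `η` into pieces `ν v` carried by `O v`, all of positive mass `p v`. It then suffices to find a
labelling `g : Ω → ℕ` moving along edges of the graph on every orbit, with `μ (g ⁻¹' {v}) = p v`: on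
each fibre of `g` the atomless `μ` can be transported to `ν v`, and whatever points are chosen
inside the sets `O v`, the edges keep the cost below `b`.

The labelling (`exists_label_of_connected`) lives on a skyscraper for `T`. Each column carries a
closed walk based at `0`, so columns can be concatenated freely. Over the base piece `D n` the walk
goes to `n`, possibly stays there, and comes back. These columns are so tall that the travel costs,
at every vertex `v` on the way, only a fraction `ε n` of `p v`, where `∑ ε n < 1`; hence no vertex
gets too much from travel. The rest of `p v` comes from staying at `v` on a suitable part of `D v`,
and vertex `0` absorbs the remaining mass.

There are infinitely many walks of uncontrolled length, so one skyscraper must have columns of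
arbitrarily fast growing heights with prescribed total masses. `exists_isSweeping_le_measure_ret`
supplies the tail of heights, and `exists_isSweeping_columns` cuts it into pieces of exact mass. -/

/-! ### Transport of atomless measures -/

open ProbabilityTheory Set Filter Topology in
theorem continuous_cdf_of_noAtoms (α : Measure ℝ) [IsProbabilityMeasure α] [NullSingletonClass α] :
    Continuous (cdf α) := by
  rw [continuous_iff_continuousAt]
  intro x
  have h1 : Function.leftLim (cdf α) x = cdf α x := by
    have h := (cdf α).measure_singleton x
    rw [measure_cdf, measure_singleton] at h
    have h2 := ENNReal.ofReal_eq_zero.1 h.symm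
    have h3 := (monotone_cdf α).leftLim_le (le_refl x)
    linarith
  rw [(monotone_cdf α).continuousAt_iff_leftLim_eq_rightLim, h1, StieltjesFunction.rightLim_eq]

open ProbabilityTheory Set Filter Topology in
theorem exists_cdf_eq (α : Measure ℝ) [IsProbabilityMeasure α] [NullSingletonClass α] {t : ℝ}
    (h0 : 0 < t) (h1 : t < 1) : ∃ x, cdf α x = t := by
  obtain ⟨y, hy⟩ := ((tendsto_cdf_atBot α).eventually (gt_mem_nhds h0)).exists
  obtain ⟨z, hz⟩ := ((tendsto_cdf_atTop α).eventually (lt_mem_nhds h1)).exists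
  obtain ⟨x, hx⟩ := mem_range_of_exists_le_of_exists_ge (continuous_cdf_of_noAtoms α)
    ⟨y, hy.le⟩ ⟨z, hz.le⟩
  exact ⟨x, hx⟩

-- The cdf of an atomless law pushes it to the uniform law: being continuous, it takes every value
-- in `(0, 1)`, so `{cdf ≤ t}` contains a half-line of mass `t` and lies in half-lines of mass `s`
-- for all `s > t` below `1`.
open ProbabilityTheory Set in
theorem exists_measurable_map_eq_volume (α : Measure ℝ) [IsProbabilityMeasure α] [NullSingletonClass α] :
    ∃ G : ℝ → unitInterval, Measurable G ∧ α.map G = volume := by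
  have hm : Measurable (fun x => (⟨cdf α x, cdf_nonneg α x, cdf_le_one α x⟩ : unitInterval)) :=
    (monotone_cdf α).measurable.subtype_mk
  refine ⟨_, hm, ?_⟩
  have : IsProbabilityMeasure (α.map fun x =>
      (⟨cdf α x, cdf_nonneg α x, cdf_le_one α x⟩ : unitInterval)) :=
    Measure.isProbabilityMeasure_map hm.aemeasurable
  refine Measure.ext_of_Iic _ _ fun t => ?_
  rw [Measure.map_apply hm measurableSet_Iic, unitInterval.volume_Iic]
  have hS : (fun x => (⟨cdf α x, cdf_nonneg α x, cdf_le_one α x⟩ : unitInterval)) ⁻¹' Iic t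
      = {x | cdf α x ≤ t} := by
    ext x; simp [← Subtype.coe_le_coe]
  rw [hS]
  rcases t with ⟨t, ht0, ht1⟩
  simp only
  rcases ht1.eq_or_lt with rfl | ht1
  · simp [cdf_le_one]
  apply le_antisymm
  · apply le_of_forall_gt_imp_ge_of_dense
    intro s hs
    rcases lt_or_ge s 1 with h1 | h1
    · have hsne : s ≠ ⊤ := ne_top_of_lt h1
      lift s to NNReal using hsne
      have hs' : t < s := by
        rw [← ENNReal.ofReal_coe_nnreal, ENNReal.ofReal_lt_ofReal_iff_of_nonneg ht0] at hs
        exact hs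
      obtain ⟨y, hy⟩ := exists_cdf_eq α (ht0.trans_lt hs') (by exact_mod_cast h1)
      calc α {x | cdf α x ≤ t} ≤ α (Iic y) := by
            apply measure_mono
            intro x hx
            by_contra h
            have := monotone_cdf α (not_le.1 h).le
            simp only [mem_ofPred_eq] at hx
            linarith
        _ = s := by rw [← ofReal_cdf, hy, ENNReal.ofReal_coe_nnreal]
    · exact prob_le_one.trans h1
  · rcases ht0.eq_or_lt with rfl | ht0
    · simp
    obtain ⟨y, hy⟩ := exists_cdf_eq α ht0 ht1
    rw [← hy, ofReal_cdf]
    exact measure_mono fun x hx => monotone_cdf α hx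

open Set in
/-- A finite measure with an atomless real random variable can be transported to any finite
measure of the same mass on a standard Borel space. -/
theorem exists_measurable_map_eq_of_noAtoms {Ω Y : Type*} [MeasurableSpace Ω] [MeasurableSpace Y]
    [StandardBorelSpace Y] [Nonempty Y] (ρ : Measure Ω) [IsFiniteMeasure ρ] {u : Ω → ℝ}
    (hu : Measurable u) (hρ : ∀ x, ρ (u ⁻¹' {x}) = 0) (β : Measure Y) (hβ : β univ = ρ univ) :
    ∃ F : Ω → Y, Measurable F ∧ ρ.map F = β := by
  by_cases h0 : ρ univ = 0
  · refine ⟨fun _ => Classical.arbitrary Y, measurable_const, ?_⟩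
    rw [h0] at hβ
    rw [Measure.measure_univ_eq_zero.1 h0, Measure.measure_univ_eq_zero.1 hβ, Measure.map_zero]
  have hfin : ρ univ ≠ ⊤ := measure_ne_top _ _
  have hp : IsProbabilityMeasure ((ρ univ)⁻¹ • ρ) :=
    ⟨by simp [ENNReal.inv_mul_cancel h0 hfin]⟩
  have hp' : IsProbabilityMeasure ((ρ univ)⁻¹ • β) :=
    ⟨by simp [hβ, ENNReal.inv_mul_cancel h0 hfin]⟩
  have := Measure.isProbabilityMeasure_map (μ := (ρ univ)⁻¹ • ρ) hu.aemeasurable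
  have : NullSingletonClass (((ρ univ)⁻¹ • ρ).map u) :=
    ⟨fun x => by rw [Measure.map_apply hu (measurableSet_singleton x)]; simp [hρ]⟩
  obtain ⟨G, hG, hGv⟩ := exists_measurable_map_eq_volume (((ρ univ)⁻¹ • ρ).map u)
  obtain ⟨Q, hQ, hQv⟩ := Measure.exists_measurable_map_eq ((ρ univ)⁻¹ • β)
  refine ⟨Q ∘ G ∘ u, hQ.comp (hG.comp hu), ?_⟩
  have h := hQv
  rw [← hGv, Measure.map_map hQ hG, Measure.map_map (hQ.comp hG) hu, Measure.map_smul] at h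
  have h2 := congrArg (fun m => ρ univ • m) h
  simpa [smul_smul, ENNReal.mul_inv_cancel h0 hfin, Function.comp_assoc] using h2

open Set in
theorem exists_measurableSet_measure_eq {Ω : Type*} [MeasurableSpace Ω]
    (ρ : Measure Ω) [IsFiniteMeasure ρ] {u : Ω → ℝ}
    (hu : Measurable u) (hρ : ∀ x, ρ (u ⁻¹' {x}) = 0) {t : ENNReal} (ht : t ≤ ρ univ) :
    ∃ D, MeasurableSet D ∧ ρ D = t := by
  obtain ⟨F, hF, h⟩ := exists_measurable_map_eq_of_noAtoms ρ hu hρ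
    (t • Measure.dirac true + (ρ univ - t) • Measure.dirac false)
    (by simp [add_tsub_cancel_of_le ht])
  refine ⟨F ⁻¹' {true}, hF (measurableSet_singleton _), ?_⟩
  rw [← Measure.map_apply hF (measurableSet_singleton _), h]
  simp

-- The isomorphism is measurable only for the completed σ-algebras, so it is first extended by `0`
-- and then replaced by an a.e. equal measurable map.
open Set in
theorem IsNonatomicLebesgueSpace.exists_uniform {Ω : Type*} [MeasurableSpace Ω] {μ : Measure Ω}
    (hμ : IsNonatomicLebesgueSpace μ) :
    ∃ u : Ω → unitInterval, Measurable u ∧ μ.map u = volume := by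
  classical
  obtain ⟨s, t, hs, ht, hs0, ht0, e, he⟩ := hμ
  have hs0' : μ sᶜ = 0 := hs0
  have ht0' : (volume : Measure unitInterval) tᶜ = 0 := ht0
  let v : Ω → unitInterval := fun ω => if h : ω ∈ s then (e ⟨ω, h⟩).1 else 0
  have hpre (B : Set unitInterval) :
      v ⁻¹' B ∩ s = Subtype.val '' (e ⁻¹' (Subtype.val ⁻¹' B)) := by
    ext ω
    constructor
    · rintro ⟨h1, h2⟩
      refine ⟨⟨ω, h2⟩, ?_, rfl⟩
      have hv : v ω = (e ⟨ω, h2⟩).1 := dif_pos h2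
      change v ω ∈ B at h1
      rwa [hv] at h1
    · rintro ⟨⟨ω', h2⟩, h1, rfl⟩
      refine ⟨?_, h2⟩
      have hv : v ω' = (e ⟨ω', h2⟩).1 := dif_pos h2
      change v ω' ∈ B
      rw [hv]
      exact h1
  have hBm (B : Set unitInterval) (hB : MeasurableSet B) :
      MeasurableSet[Subtype.instMeasurableSpace (m := (inferInstance :
        MeasurableSpace (NullMeasurableSpace unitInterval volume)))]
        (Subtype.val ⁻¹' B : Set t) :=
    ⟨B, hB.nullMeasurableSet, rfl⟩
  have hmeas (B : Set unitInterval) (hB : MeasurableSet B) :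
      NullMeasurableSet (v ⁻¹' B ∩ s) μ := by
    rw [hpre]
    obtain ⟨C, hC, hCe⟩ := e.measurable (hBm B hB)
    rw [← hCe, Subtype.image_preimage_coe]
    exact MeasurableSet.inter (α := NullMeasurableSpace Ω μ) hs hC
  have hval (B : Set unitInterval) (hB : MeasurableSet B) :
      μ (v ⁻¹' B ∩ s) = volume B := by
    rw [hpre]
    have h := he.measure_preimage (hBm B hB).nullMeasurableSet
    rw [Measure.comap_apply _ Subtype.val_injective (fun a ha => hs.subtype_image ha) _
      (e.measurable (hBm B hB)), Measure.comap_apply _ Subtype.val_injective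
      (fun a ha => ht.subtype_image ha) _ (hBm B hB)] at h
    rw [Measure.coe_completion, Measure.coe_completion] at h
    refine h.trans ((congrArg (volume : Measure unitInterval)
      ((Subtype.image_preimage_coe t B).trans (inter_comm _ _))).trans ?_)
    exact measure_inter_conull ht0'
  have hv : NullMeasurable v μ := fun B hB => by
    have : v ⁻¹' B =ᵐ[μ] (v ⁻¹' B ∩ s : Set Ω) := by
      exact (inter_ae_eq_left_of_ae_eq_univ (ae_eq_univ.2 hs0')).symm
    exact (hmeas B hB).congr this.symm
  have hva : AEMeasurable v μ := hv.aemeasurable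
  refine ⟨hva.mk v, hva.measurable_mk, ?_⟩
  rw [← Measure.map_congr hva.ae_eq_mk]
  ext B hB
  rw [Measure.map_apply_of_aemeasurable hva hB, ← hval B hB, measure_inter_conull hs0']

/-! ### Skyscrapers over a sweeping set -/

/-- A measurable set that every orbit visits, in the past (possibly now) and in the strict
future. -/
structure IsSweeping {Ω : Type*} [MeasurableSpace Ω] (T : Ω ≃ᵐ Ω) (A : Set Ω) : Prop where
  measurableSet : MeasurableSet A
  past : ∀ ω, ∃ j, T.symm^[j] ω ∈ A
  future : ∀ ω, ∃ j, T^[j + 1] ω ∈ A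

namespace IsSweeping

variable {Ω : Type*} [MeasurableSpace Ω] {T : Ω ≃ᵐ Ω} {A : Set Ω}

open Classical in
/-- The time since the last visit to `A`. -/
noncomputable def age (h : IsSweeping T A) (ω : Ω) : ℕ := Nat.find (h.past ω)

/-- The last point of the orbit in `A`. -/
noncomputable def base (h : IsSweeping T A) (ω : Ω) : Ω := T.symm^[h.age ω] ω

open Classical in
/-- The time until the next visit to `A`. -/
noncomputable def ret (h : IsSweeping T A) (ω : Ω) : ℕ := Nat.find (h.future ω) + 1

theorem base_mem (h : IsSweeping T A) (ω : Ω) : h.base ω ∈ A := by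
  classical exact Nat.find_spec (h.past ω)

theorem iterate_age_base (h : IsSweeping T A) (ω : Ω) : T^[h.age ω] (h.base ω) = ω :=
  (Function.LeftInverse.iterate (f := T.symm) (g := T) T.apply_symm_apply _) ω

theorem age_of_mem (h : IsSweeping T A) {ω : Ω} (hω : ω ∈ A) : h.age ω = 0 := by
  classical exact (Nat.find_eq_zero _).2 hω

theorem base_of_mem (h : IsSweeping T A) {ω : Ω} (hω : ω ∈ A) : h.base ω = ω := by
  simp [base, h.age_of_mem hω]

theorem age_apply (h : IsSweeping T A) {ω : Ω} (hω : T ω ∉ A) : h.age (T ω) = h.age ω + 1 := by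
  classical
  refine (Nat.find_eq_iff _).2 ⟨?_, ?_⟩
  · rw [Function.iterate_succ_apply, T.symm_apply_apply]
    exact h.base_mem ω
  · rintro (_ | n) hn
    · exact hω
    · rw [Function.iterate_succ_apply, T.symm_apply_apply]
      exact Nat.find_min (h.past ω) (Nat.lt_of_succ_lt_succ hn)

theorem base_apply (h : IsSweeping T A) {ω : Ω} (hω : T ω ∉ A) : h.base (T ω) = h.base ω := by
  rw [base, h.age_apply hω, Function.iterate_succ_apply, T.symm_apply_apply, base]

theorem iterate_ret_mem (h : IsSweeping T A) (ω : Ω) : T^[h.ret ω] ω ∈ A := by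
  classical exact Nat.find_spec (h.future ω)

theorem iterate_notMem (h : IsSweeping T A) {ω : Ω} {j : ℕ} (h0 : 0 < j) (hj : j < h.ret ω) :
    T^[j] ω ∉ A := by
  classical
  obtain ⟨j, rfl⟩ := Nat.exists_eq_succ_of_ne_zero h0.ne'
  exact Nat.find_min (h.future ω) (by rw [ret] at hj; omega)

theorem ret_le (h : IsSweeping T A) {ω : Ω} {j : ℕ} (h0 : 0 < j) (hj : T^[j] ω ∈ A) :
    h.ret ω ≤ j := not_lt.1 fun hlt => h.iterate_notMem h0 hlt hj

theorem ret_pos (h : IsSweeping T A) (ω : Ω) : 0 < h.ret ω := Nat.succ_pos _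

theorem age_lt_ret (h : IsSweeping T A) (ω : Ω) : h.age ω < h.ret (h.base ω) := by
  classical
  by_contra! hle
  have h1 := h.iterate_ret_mem (h.base ω)
  have hr := h.ret_pos (h.base ω)
  refine Nat.find_min (h.past ω) (m := h.age ω - h.ret (h.base ω)) (by rw [age] at *; omega) ?_
  convert h1 using 1
  have h2 : ω = T^[h.age ω - h.ret (h.base ω)] (T^[h.ret (h.base ω)] (h.base ω)) := by
    rw [← Function.iterate_add_apply, Nat.sub_add_cancel hle, h.iterate_age_base]
  exact (congrArg T.symm^[h.age ω - h.ret (h.base ω)] h2).trans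
    ((Function.LeftInverse.iterate (f := T) (g := T.symm) T.symm_apply_apply _) _)

theorem age_add_one_eq_ret (h : IsSweeping T A) {ω : Ω} (hω : T ω ∈ A) :
    h.age ω + 1 = h.ret (h.base ω) := by
  refine le_antisymm (h.age_lt_ret ω) (h.ret_le (Nat.succ_pos _) ?_)
  rwa [Function.iterate_succ_apply', h.iterate_age_base]

theorem age_base_iterate (h : IsSweeping T A) {ω : Ω} (hω : ω ∈ A) {j : ℕ} (hj : j < h.ret ω) :
    h.age (T^[j] ω) = j ∧ h.base (T^[j] ω) = ω := by
  induction j with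
  | zero => exact ⟨h.age_of_mem hω, h.base_of_mem hω⟩
  | succ j ih =>
    obtain ⟨h1, h2⟩ := ih (by omega)
    have h3 := h.iterate_notMem (Nat.succ_pos j) hj
    rw [Function.iterate_succ_apply'] at h3 ⊢
    rw [h.age_apply h3, h.base_apply h3, h1, h2]
    exact ⟨rfl, rfl⟩

theorem measurable_age (h : IsSweeping T A) : Measurable h.age := by
  classical
  exact measurable_find h.past fun k => (T.symm.measurable.iterate k) h.measurableSet

theorem measurable_ret (h : IsSweeping T A) : Measurable h.ret := by
  classical
  exact (measurable_from_nat (f := fun n => n + 1)).comp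
    (measurable_find h.future fun k => (T.measurable.iterate (k + 1)) h.measurableSet)

theorem measurable_base (h : IsSweeping T A) : Measurable h.base := by
  have : Measurable (fun p : ℕ × Ω => T.symm^[p.1] p.2) :=
    measurable_from_prod_countable_right fun n => T.symm.measurable.iterate n
  exact this.comp (h.measurable_age.prodMk measurable_id)

/-- Cut `E` by age: level `j` of the skyscraper is the image under `T^[j]` of the base points with
return time above `j`, and `T^[j]` preserves `μ`. -/
theorem measure_eq_tsum (h : IsSweeping T A) {μ : Measure Ω} (hT : MeasurePreserving T μ μ)
    {E : Set Ω} (hE : MeasurableSet E) :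
    μ E = ∑' j, μ (A ∩ {ω | j < h.ret ω} ∩ T^[j] ⁻¹' E) := by
  have h1 : E = ⋃ j, (E ∩ h.age ⁻¹' {j}) := by
    rw [← Set.inter_iUnion, ← Set.preimage_iUnion, Set.iUnion_of_singleton, Set.preimage_univ,
      Set.inter_univ]
  have hm (j : ℕ) : MeasurableSet (E ∩ h.age ⁻¹' {j}) :=
    hE.inter (h.measurable_age (measurableSet_singleton j))
  conv_lhs => rw [h1]
  rw [measure_iUnion (fun i j hij => ?_) hm]
  · refine tsum_congr fun j => ?_
    rw [← (hT.iterate j).measure_preimage (hm j).nullMeasurableSet]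
    congr 1
    ext ω
    simp only [Set.mem_preimage, Set.mem_inter_iff, Set.mem_singleton_iff, Set.mem_ofPred_eq]
    constructor
    · rintro ⟨h2, h3⟩
      have hb : h.base (T^[j] ω) = ω := by
        rw [base, h3]
        exact (Function.LeftInverse.iterate (f := T) (g := T.symm) T.symm_apply_apply _) _
      have h4 := h.base_mem (T^[j] ω)
      have h5 := h.age_lt_ret (T^[j] ω)
      rw [hb] at h4 h5
      exact ⟨⟨h4, h3 ▸ h5⟩, h2⟩
    · rintro ⟨⟨h2, h3⟩, h4⟩
      exact ⟨h4, (h.age_base_iterate h2 h3).1⟩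
  · refine Disjoint.mono Set.inter_subset_right Set.inter_subset_right ?_
    exact Disjoint.preimage _ (Set.disjoint_singleton.2 hij)

theorem measure_base_preimage_null (h : IsSweeping T A) {μ : Measure Ω}
    (hT : MeasurePreserving T μ μ) {Z : Set Ω} (hZ : μ Z = 0) :
    μ (h.base ⁻¹' Z) = 0 := by
  have hsub : h.base ⁻¹' Z ⊆ ⋃ j, T.symm^[j] ⁻¹' Z := fun ω hω => Set.mem_iUnion.2 ⟨h.age ω, hω⟩
  refine measure_mono_null hsub (measure_iUnion_null fun j => ?_)
  exact ((MeasurePreserving.symm T hT).iterate j).quasiMeasurePreserving.preimage_null hZ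

theorem tsum_getElem?_eq_count (l : List ℕ) (v : ℕ) :
    ∑' j : ℕ, (if l[j]? = some v then (1 : ENNReal) else 0) = l.count v := by
  induction l with
  | nil => simp
  | cons a l ih =>
    rw [tsum_eq_zero_add' ENNReal.summable]
    simp only [List.getElem?_cons_zero, List.getElem?_cons_succ, ih, Option.some.injEq,
      List.count_cons, beq_iff_eq]
    push_cast
    rw [add_comm]

/-- The label of a point when the columns of the skyscraper over `A` carry words. -/
noncomputable def label (h : IsSweeping T A) (W : Ω → List ℕ) (ω : Ω) : ℕ :=
  (W (h.base ω))[h.age ω]?.getD 0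

theorem measurable_label (h : IsSweeping T A) {W : Ω → List ℕ} (hW : Measurable[_, ⊤] W) :
    Measurable (h.label W) := by
  let _ : MeasurableSpace (List ℕ) := ⊤
  have : Measurable (fun p : List ℕ × ℕ => p.1[p.2]?.getD 0) := measurable_of_countable _
  exact this.comp ((hW.comp h.measurable_base).prodMk h.measurable_age)

/-- A base point `ω` contributes one for every level of its column that bears `v`, which is the
count of `v` in its word. -/
theorem measure_label (h : IsSweeping T A) {μ : Measure Ω} (hT : MeasurePreserving T μ μ)
    {W : Ω → List ℕ} (hW : Measurable[_, ⊤] W) (hlen : ∀ ω ∈ A, (W ω).length = h.ret ω) (v : ℕ) :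
    μ (h.label W ⁻¹' {v}) = ∫⁻ ω in A, ((W ω).count v : ENNReal) ∂μ := by
  rw [h.measure_eq_tsum hT (h.measurable_label hW (measurableSet_singleton v))]
  simp_rw [← tsum_getElem?_eq_count]
  have hm (j : ℕ) : MeasurableSet {ω | (W ω)[j]? = some v} := hW (t := {l | l[j]? = some v}) trivial
  rw [lintegral_tsum fun j => (Measurable.ite (hm j) measurable_const measurable_const).aemeasurable]
  refine tsum_congr fun j => ?_
  have : (fun ω => if (W ω)[j]? = some v then (1 : ENNReal) else 0)
      = {ω | (W ω)[j]? = some v}.indicator 1 := by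
    ext ω; simp [Set.indicator_apply]
  rw [this, lintegral_indicator_one (hm j), Measure.restrict_apply (hm j)]
  congr 1
  ext ω
  simp only [Set.mem_inter_iff, Set.mem_ofPred_eq, Set.mem_preimage, Set.mem_singleton_iff]
  constructor
  · rintro ⟨⟨h1, h2⟩, h3⟩
    obtain ⟨h4, h5⟩ := h.age_base_iterate h1 h2
    rw [label, h4, h5, List.getElem?_eq_getElem (by rwa [hlen ω h1])] at h3
    rw [List.getElem?_eq_getElem (by rwa [hlen ω h1])]
    exact ⟨congrArg some h3, h1⟩
  · rintro ⟨h3, h1⟩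
    obtain ⟨h2, -⟩ := List.getElem?_eq_some_iff.1 h3
    rw [hlen ω h1] at h2
    obtain ⟨h4, h5⟩ := h.age_base_iterate h1 h2
    refine ⟨⟨h1, h2⟩, ?_⟩
    rw [label, h4, h5, h3, Option.getD_some]

/-- Kac's formula: the column over `ω` has `h.ret ω` levels. -/
theorem measure_base_preimage (h : IsSweeping T A) {μ : Measure Ω}
    (hT : MeasurePreserving T μ μ) {D : Set Ω} (hD : MeasurableSet D) (hDA : D ⊆ A) :
    μ (h.base ⁻¹' D) = ∫⁻ ω in D, (h.ret ω : ENNReal) ∂μ := by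
  rw [h.measure_eq_tsum hT (h.measurable_base hD)]
  have hr (ω : Ω) : (h.ret ω : ENNReal) = ∑' j, if j < h.ret ω then (1 : ENNReal) else 0 := by
    rw [tsum_eq_sum (s := Finset.range (h.ret ω)) (by intro j hj; simpa using hj),
      Finset.sum_ite_of_true (by simp)]
    simp
  simp_rw [hr]
  have hm (j : ℕ) : MeasurableSet {ω | j < h.ret ω} := measurableSet_lt measurable_const h.measurable_ret
  rw [lintegral_tsum fun j => (Measurable.ite (hm j) measurable_const measurable_const).aemeasurable]
  refine tsum_congr fun j => ?_
  have : (fun ω => if j < h.ret ω then (1 : ENNReal) else 0)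
      = {ω | j < h.ret ω}.indicator 1 := by
    ext ω; simp [Set.indicator_apply]
  rw [this, lintegral_indicator_one (hm j), Measure.restrict_apply (hm j)]
  congr 1
  ext ω
  simp only [Set.mem_inter_iff, Set.mem_ofPred_eq, Set.mem_preimage]
  constructor
  · rintro ⟨⟨h1, h2⟩, h3⟩
    rw [(h.age_base_iterate h1 h2).2] at h3
    exact ⟨h2, h3⟩
  · rintro ⟨h2, h3⟩
    refine ⟨⟨hDA h3, h2⟩, ?_⟩
    rwa [(h.age_base_iterate (hDA h3) h2).2]

/-- If all words are walks from `0` to `0` along the columns, so is the labelling along orbits. -/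
theorem label_rel (h : IsSweeping T A) {W : Ω → List ℕ}
    (hlen : ∀ ω ∈ A, (W ω).length = h.ret ω) {r : ℕ → ℕ → Prop} (hr : r 0 0)
    (hchain : ∀ ω ∈ A, (W ω).IsChain r) (hhead : ∀ ω ∈ A, (W ω).head? = some 0)
    (hlast : ∀ ω ∈ A, (W ω).getLast? = some 0) (ω : Ω) :
    r (h.label W ω) (h.label W (T ω)) := by
  have hb := h.base_mem ω
  have hlt := h.age_lt_ret ω
  rw [← hlen _ hb] at hlt
  by_cases hA : T ω ∈ A
  · have h1 : h.label W ω = 0 := by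
      have h2 := hlast _ hb
      rw [List.getLast?_eq_getElem?, hlen _ hb, ← h.age_add_one_eq_ret hA, Nat.add_sub_cancel] at h2
      rw [label, h2, Option.getD_some]
    have h3 : h.label W (T ω) = 0 := by
      have h2 := hhead _ hA
      rw [List.head?_eq_getElem?] at h2
      rw [label, h.base_of_mem hA, h.age_of_mem hA, h2, Option.getD_some]
    rwa [h1, h3]
  · have hlt' := h.age_lt_ret (T ω)
    rw [h.base_apply hA, h.age_apply hA, ← hlen _ hb] at hlt'
    rw [label, label, h.base_apply hA, h.age_apply hA, List.getElem?_eq_getElem hlt,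
      List.getElem?_eq_getElem hlt', Option.getD_some, Option.getD_some]
    exact List.isChain_iff_getElem.1 (hchain _ hb) _ hlt'

end IsSweeping

/-! ### Sweeping sets with prescribed masses of tall columns -/

open Set in
theorem measure_compl_iUnion_iterate_preimage {Ω : Type*} [MeasurableSpace Ω] {μ : Measure Ω}
    [IsProbabilityMeasure μ] {S : Ω → Ω} (hS : Ergodic S μ) {A : Set Ω} (hA : MeasurableSet A)
    (h0 : μ A ≠ 0) : μ (⋃ j, S^[j] ⁻¹' A)ᶜ = 0 := by
  have hm : MeasurableSet (⋃ j, S^[j] ⁻¹' A) :=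
    MeasurableSet.iUnion fun j => (hS.measurable.iterate j) hA
  have hle : S ⁻¹' (⋃ j, S^[j] ⁻¹' A) ⊆ ⋃ j, S^[j] ⁻¹' A := by
    intro ω hω
    obtain ⟨j, hj⟩ := mem_iUnion.1 hω
    exact mem_iUnion.2 ⟨j + 1, hj⟩
  rcases hS.ae_empty_or_univ_of_preimage_ae_le hm.nullMeasurableSet hle.eventuallyLE with h | h
  · exact absurd (measure_mono_null (subset_iUnion (fun j => S^[j] ⁻¹' A) 0) (ae_eq_empty.1 h)) h0
  · exact ae_eq_univ.1 h

-- The points missing `A` in the past or the future are null by ergodicity. Adding their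
-- `T`-saturation `N`, still null, makes every orbit recur, which is what later gives the cost bound
-- at every point.
open Set in
theorem exists_null_union_isSweeping {Ω : Type*} [MeasurableSpace Ω] {μ : Measure Ω}
    [IsProbabilityMeasure μ] {T : Ω ≃ᵐ Ω} (hT : Ergodic T μ) {A : Set Ω} (hA : MeasurableSet A)
    (h0 : μ A ≠ 0) :
    ∃ N, μ N = 0 ∧ (∀ ω, T ω ∈ N ↔ ω ∈ N) ∧ IsSweeping T (A ∪ N) := by
  have h1 := measure_compl_iUnion_iterate_preimage hT hA h0
  have h2 := measure_compl_iUnion_iterate_preimage hT.symm hA h0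
  set P := (⋃ j, T^[j] ⁻¹' A)ᶜ with hP
  set Q := (⋃ j, T.symm^[j] ⁻¹' A)ᶜ with hQ
  have hPm : MeasurableSet P :=
    (MeasurableSet.iUnion fun j => (T.measurable.iterate j) hA).compl
  have hQm : MeasurableSet Q :=
    (MeasurableSet.iUnion fun j => (T.symm.measurable.iterate j) hA).compl
  set N := (⋃ j, T^[j] ⁻¹' (P ∪ Q)) ∪ ⋃ j, T.symm^[j] ⁻¹' (P ∪ Q) with hN
  have hPQ : μ (P ∪ Q) = 0 := measure_union_null h1 h2
  have hsub : P ∪ Q ⊆ N := fun ω hω => Or.inl (mem_iUnion.2 ⟨0, hω⟩)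
  have hinv (ω : Ω) : T ω ∈ N ↔ ω ∈ N := by
    constructor
    · rintro (h | h)
      · obtain ⟨j, hj⟩ := mem_iUnion.1 h
        exact Or.inl (mem_iUnion.2 ⟨j + 1, hj⟩)
      · obtain ⟨_ | j, hj⟩ := mem_iUnion.1 h
        · exact Or.inl (mem_iUnion.2 ⟨1, hj⟩)
        · refine Or.inr (mem_iUnion.2 ⟨j, ?_⟩)
          rwa [mem_preimage, Function.iterate_succ_apply, T.symm_apply_apply] at hj
    · rintro (h | h)
      · obtain ⟨_ | j, hj⟩ := mem_iUnion.1 h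
        · refine Or.inr (mem_iUnion.2 ⟨1, ?_⟩)
          rw [mem_preimage, Function.iterate_succ_apply, T.symm_apply_apply]
          exact hj
        · exact Or.inl (mem_iUnion.2 ⟨j, hj⟩)
      · obtain ⟨j, hj⟩ := mem_iUnion.1 h
        refine Or.inr (mem_iUnion.2 ⟨j + 1, ?_⟩)
        rw [mem_preimage, Function.iterate_succ_apply, T.symm_apply_apply]
        exact hj
  refine ⟨N, ?_, hinv, ⟨?_, ?_, ?_⟩⟩
  · refine measure_union_null (measure_iUnion_null fun j => ?_) (measure_iUnion_null fun j => ?_)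
    · exact (hT.toMeasurePreserving.iterate j).quasiMeasurePreserving.preimage_null hPQ
    · exact (hT.symm.toMeasurePreserving.iterate j).quasiMeasurePreserving.preimage_null hPQ
  · refine hA.union (MeasurableSet.union ?_ ?_)
    · exact MeasurableSet.iUnion fun j => (T.measurable.iterate j) (hPm.union hQm)
    · exact MeasurableSet.iUnion fun j => (T.symm.measurable.iterate j) (hPm.union hQm)
  · intro ω
    by_cases hω : ω ∈ N
    · exact ⟨0, Or.inr hω⟩
    · have : ω ∉ Q := fun h => hω (hsub (Or.inr h))
      rw [hQ, notMem_compl_iff, mem_iUnion] at this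
      exact this.imp fun j hj => Or.inl hj
  · intro ω
    by_cases hω : ω ∈ N
    · exact ⟨0, Or.inr ((hinv ω).2 hω)⟩
    · have : T ω ∉ P := fun h => hω ((hinv ω).1 (hsub (Or.inl h)))
      rw [hP, notMem_compl_iff, mem_iUnion] at this
      exact this.imp fun j hj => Or.inl hj

-- For `E = {u < s}` the measure of the union is `H`-Lipschitz in `s`, so it takes all values
-- between `0` and `1`. The translates of `E` need not be disjoint.
open Set in
theorem exists_measure_biUnion_iterate_eq {Ω : Type*} [MeasurableSpace Ω] {μ : Measure Ω}
    [IsProbabilityMeasure μ] {T : Ω ≃ᵐ Ω} (hT : MeasurePreserving T μ μ)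
    {u : Ω → unitInterval} (hu : Measurable u) (huv : μ.map u = volume) (H : ℕ) (hH : 0 < H)
    {σ : ENNReal} (hσ : σ ≤ 1) :
    ∃ E, MeasurableSet E ∧ μ (⋃ l ∈ Finset.range H, T.symm^[l] ⁻¹' E) = σ := by
  let E : ℝ → Set Ω := fun s => {ω | (u ω : ℝ) < s}
  have hu' : Measurable (fun ω => (u ω : ℝ)) := measurable_subtype_coe.comp hu
  have hE (s) : MeasurableSet (E s) := measurableSet_lt hu' measurable_const
  let φ : ℝ → ℝ := fun s => μ.real (⋃ l ∈ Finset.range H, T.symm^[l] ⁻¹' E s)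
  have hlaw (x y : ℝ) : μ {ω | y ≤ (u ω : ℝ) ∧ (u ω : ℝ) < x} ≤ ENNReal.ofReal (x - y) := by
    have hm : MeasurableSet {a : unitInterval | y ≤ (a : ℝ) ∧ (a : ℝ) < x} :=
      measurable_subtype_coe measurableSet_Ico
    have : {ω | y ≤ (u ω : ℝ) ∧ (u ω : ℝ) < x}
      = u ⁻¹' {a : unitInterval | y ≤ (a : ℝ) ∧ (a : ℝ) < x} := rfl
    rw [this, ← Measure.map_apply hu hm, huv, unitInterval.volume_apply, ← Real.volume_Ico]
    refine measure_mono ?_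
    rintro _ ⟨a, ha, rfl⟩
    exact ha
  have hlip : LipschitzWith H φ := by
    refine LipschitzWith.of_le_add_mul _ fun x y => ?_
    have hsub : (⋃ l ∈ Finset.range H, T.symm^[l] ⁻¹' E x) ⊆
        (⋃ l ∈ Finset.range H, T.symm^[l] ⁻¹' E y) ∪
        ⋃ l ∈ Finset.range H, T.symm^[l] ⁻¹' {ω | y ≤ (u ω : ℝ) ∧ (u ω : ℝ) < x} := by
      intro ω hω
      obtain ⟨l, hl, hω⟩ := mem_iUnion₂.1 hω
      by_cases h : (u (T.symm^[l] ω) : ℝ) < y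
      · exact Or.inl (mem_iUnion₂.2 ⟨l, hl, h⟩)
      · exact Or.inr (mem_iUnion₂.2 ⟨l, hl, not_lt.1 h, hω⟩)
    have hmI : MeasurableSet {ω | y ≤ (u ω : ℝ) ∧ (u ω : ℝ) < x} :=
      hu' measurableSet_Ico
    have h1 : μ.real (⋃ l ∈ Finset.range H,
        T.symm^[l] ⁻¹' {ω | y ≤ (u ω : ℝ) ∧ (u ω : ℝ) < x}) ≤ H * dist x y := by
      refine (measureReal_biUnion_finset_le _ _).trans ?_
      refine (Finset.sum_le_card_nsmul _ _ (dist x y) fun l _ => ?_).trans (by simp)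
      rw [measureReal_def,
        ((MeasurePreserving.symm T hT).iterate l).measure_preimage hmI.nullMeasurableSet]
      refine ENNReal.toReal_le_of_le_ofReal dist_nonneg ((hlaw x y).trans ?_)
      exact ENNReal.ofReal_le_ofReal (le_abs_self _)
    calc φ x ≤ _ := measureReal_mono hsub
      _ ≤ _ := measureReal_union_le _ _
      _ ≤ _ := by
        gcongr
        exact_mod_cast h1
  have h0 : φ 0 = 0 := by
    have : E 0 = ∅ := by
      ext ω; simpa [E] using (u ω).2.1
    simp [φ, this]
  have h2 : φ 2 = 1 := by
    have : E 2 = univ := by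
      ext ω
      have := (u ω).2.2
      simp only [E, mem_ofPred_eq, mem_univ, iff_true]
      linarith
    simp only [φ, this, preimage_univ]
    rw [eq_univ_of_forall fun ω => mem_iUnion₂.2 ⟨0, Finset.mem_range.2 hH, mem_univ ω⟩]
    simp
  have hσt : σ ≠ ⊤ := ne_top_of_le_ne_top ENNReal.one_ne_top hσ
  obtain ⟨s, hs⟩ := mem_range_of_exists_le_of_exists_ge hlip.continuous (c := σ.toReal)
    ⟨0, by rw [h0]; exact ENNReal.toReal_nonneg⟩
    ⟨2, by rw [h2]; exact ENNReal.toReal_mono ENNReal.one_ne_top hσ⟩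
  refine ⟨E s, hE s, ?_⟩
  exact (ENNReal.toReal_eq_toReal_iff' (measure_ne_top _ _) hσt).1 hs

-- Forbid base points strictly inside orbit segments of length `L + 1`: every column meeting such a
-- segment has height above `L`. Segments of several lengths coexist because their total mass stays
-- below `1`, leaving a base of positive measure.
open Set Filter Topology in
theorem exists_isSweeping_le_measure_ret {Ω : Type*} [MeasurableSpace Ω] {μ : Measure Ω}
    [IsProbabilityMeasure μ] {T : Ω ≃ᵐ Ω} (hT : Ergodic T μ)
    {u : Ω → unitInterval} (hu : Measurable u) (huv : μ.map u = volume)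
    {L : ℕ → ℕ} (hL : Monotone L) {τ : ℕ → ENNReal} (hτ : Antitone τ) (hτ0 : τ 0 < 1)
    (hlim : Tendsto τ atTop (𝓝 0)) :
    ∃ (A : Set Ω) (h : IsSweeping T A), ∀ n, τ n ≤ μ {ω | L n ≤ h.ret (h.base ω)} := by
  obtain ⟨σ, hσ0, hσ⟩ := ENNReal.exists_pos_sum_of_countable (tsub_pos_of_lt hτ0).ne' ℕ
  have hm (i : ℕ) : ∃ m, i ≤ m ∧ τ m ≤ σ i :=
    ((eventually_ge_atTop i).and (hlim.eventually_le_const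
      (ENNReal.coe_pos.2 (hσ0 i)))).exists
  choose m him hm using hm
  -- Stage `0` uses the full `τ 0`; stage `j + 1` uses `σ j`, which dominates `τ (m j)`, so that the
  -- masses sum to less than `1`.
  let s : ℕ → ENNReal := fun i => Nat.casesOn i (τ 0) fun j => σ j
  have hsum : ∑' i, s i < 1 := by
    rw [tsum_eq_zero_add' ENNReal.summable]
    exact lt_tsub_iff_left.1 hσ
  have hE (i : ℕ) := exists_measure_biUnion_iterate_eq hT.toMeasurePreserving hu huv
    (L (m i) + 1) (Nat.succ_pos _) ((ENNReal.le_tsum i).trans hsum.le : s i ≤ 1)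
  choose E hEm hE using hE
  set U : ℕ → Set Ω := fun i => ⋃ l ∈ Finset.range (L (m i) + 1), T.symm^[l] ⁻¹' E i with hU
  have hUm (i) : MeasurableSet (U i) :=
    Finset.measurableSet_biUnion _ fun l _ => (T.symm.measurable.iterate l) (hEm i)
  -- A point of `U i` whose predecessor is also in `U i` is barred from the base.
  set A₀ : Set Ω := (⋃ i, (T.symm ⁻¹' U i ∩ U i))ᶜ with hA₀
  have hA₀m : MeasurableSet A₀ :=
    (MeasurableSet.iUnion fun i => (T.symm.measurable (hUm i)).inter (hUm i)).compl
  have hA₀0 : μ A₀ ≠ 0 := by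
    intro h
    have h1 : μ (⋃ i, (T.symm ⁻¹' U i ∩ U i)) < 1 :=
      (measure_mono (iUnion_mono fun i => inter_subset_right)).trans_lt
        ((measure_iUnion_le U).trans_lt ((tsum_congr hE).trans_lt hsum))
    rw [prob_compl_eq_zero_iff hA₀m.of_compl] at h
    exact h1.ne h
  obtain ⟨N, hN0, hNinv, hsw⟩ := exists_null_union_isSweeping hT hA₀m hA₀0
  refine ⟨A₀ ∪ N, hsw, fun n => ?_⟩
  have key (i : ℕ) : s i ≤ μ {ω | L (m i) ≤ hsw.ret (hsw.base ω)} := by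
    rw [← hE i]
    refine (measure_mono (?_ : U i ⊆ {ω | L (m i) ≤ hsw.ret (hsw.base ω)} ∪ N)).trans
      ((measure_union_le _ _).trans (by rw [hN0, add_zero]))
    intro ω hω
    by_cases hωN : ω ∈ N
    · exact Or.inr hωN
    left
    obtain ⟨l, hl, he⟩ := mem_iUnion₂.1 hω
    rw [mem_preimage] at he
    have hωe : ω = T^[l] (T.symm^[l] ω) :=
      ((Function.LeftInverse.iterate (f := T.symm) (g := T) T.apply_symm_apply _) _).symm
    set e := T.symm^[l] ω with hedef
    have hiter (j : ℕ) : T^[j] e ∈ N ↔ e ∈ N := by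
      induction j with
      | zero => rfl
      | succ j ih => rw [Function.iterate_succ_apply', hNinv, ih]
    have heN : e ∉ N := by
      rw [← hiter l, ← hωe]
      exact hωN
    have hmemU (j : ℕ) (hj : j < L (m i) + 1) : T^[j] e ∈ U i := by
      refine mem_iUnion₂.2 ⟨j, Finset.mem_range.2 hj, ?_⟩
      rw [mem_preimage,
        Function.LeftInverse.iterate (f := T) (g := T.symm) T.symm_apply_apply]
      exact he
    have hcol (j : ℕ) (hj : j < L (m i) + 1) :
        hsw.age (T^[j] e) = hsw.age e + j ∧ hsw.base (T^[j] e) = hsw.base e := by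
      induction j with
      | zero => exact ⟨rfl, rfl⟩
      | succ j ih =>
        obtain ⟨h1, h2⟩ := ih (by omega)
        have hnot : T (T^[j] e) ∉ A₀ ∪ N := by
          rintro (h | h)
          · refine h (mem_iUnion.2 ⟨i, ?_, ?_⟩)
            · rw [mem_preimage, T.symm_apply_apply]
              exact hmemU j (by omega)
            · rw [← Function.iterate_succ_apply' T]
              exact hmemU _ hj
          · rw [← Function.iterate_succ_apply' T, hiter] at h
            exact heN h
        rw [Function.iterate_succ_apply', hsw.age_apply hnot, hsw.base_apply hnot, h1, h2]
        exact ⟨rfl, rfl⟩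
    have h1 := hsw.age_lt_ret (T^[L (m i)] e)
    obtain ⟨h2, h3⟩ := hcol (L (m i)) (Nat.lt_succ_self _)
    rw [h2, h3, ← (hcol l (Finset.mem_range.1 hl)).2, ← hωe] at h1
    rw [mem_ofPred_eq]
    omega
  classical
  -- Serve `n` by the first stage `i` with `n ≤ m i`: it is tall enough, and as stage `i - 1` has `m
  -- (i - 1) < n`, its mass dominates `τ n`.
  have hex : ∃ i, n ≤ m i := ⟨n, him n⟩
  have hspec := Nat.find_spec hex
  have hmin := fun k => Nat.find_min (H := hex) (m := k)
  have hle : τ n ≤ s (Nat.find hex) := by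
    generalize Nat.find hex = i at hspec hmin
    rcases i with _ | j
    · exact hτ (Nat.zero_le n)
    · exact (hτ (not_le.1 (hmin j (Nat.lt_succ_self j))).le).trans (hm j)
  refine hle.trans ((key _).trans (measure_mono fun ω hω => (hL hspec).trans hω))

open Set in
theorem measure_coe_preimage_singleton {Ω : Type*} [MeasurableSpace Ω] {μ : Measure Ω}
    {u : Ω → unitInterval} (hu : Measurable u) (huv : μ.map u = volume) (x : ℝ) :
    μ ((fun ω => (u ω : ℝ)) ⁻¹' {x}) = 0 := by
  have hm : MeasurableSet ((fun a : unitInterval => (a : ℝ)) ⁻¹' {x}) :=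
    measurable_subtype_coe (measurableSet_singleton x)
  have : (fun ω => (u ω : ℝ)) ⁻¹' {x} = u ⁻¹' ((fun a : unitInterval => (a : ℝ)) ⁻¹' {x}) := rfl
  rw [this, ← Measure.map_apply hu hm, huv, unitInterval.volume_apply]
  exact measure_mono_null (image_preimage_subset _ _) (by simp)

-- If the half-line of mass `t` starts below `y`, then `Ici y` lies inside it and itself has mass
-- `t`.
open Set Filter ProbabilityTheory in
theorem exists_le_measure_Ici_eq (α : Measure ℝ) [IsProbabilityMeasure α] [NullSingletonClass α]
    {t : ENNReal} (h0 : 0 < t) (h1 : t < 1) {y : ℝ} (hy : t ≤ α (Ici y)) :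
    ∃ x, y ≤ x ∧ α (Ici x) = t := by
  have ht : t ≠ ⊤ := ne_top_of_lt h1
  have h0' : 0 < t.toReal := ENNReal.toReal_pos h0.ne' ht
  have h1' : t.toReal < 1 := by
    simpa using (ENNReal.toReal_lt_toReal ht ENNReal.one_ne_top).2 h1
  obtain ⟨x, hx⟩ := exists_cdf_eq α (t := 1 - t.toReal) (by linarith) (by linarith)
  have hxt : α (Ici x) = t := by
    rw [← measure_congr (Ioi_ae_eq_Ici (μ := α) (a := x)), ← compl_Iic,
      prob_compl_eq_one_sub measurableSet_Iic, ← ofReal_cdf, hx,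
      ENNReal.ofReal_sub _ h0'.le, ENNReal.ofReal_one, ENNReal.ofReal_toReal ht,
      ENNReal.sub_sub_cancel ENNReal.one_ne_top h1.le]
  rcases le_total y x with h | h
  · exact ⟨x, h, hxt⟩
  · exact ⟨y, le_rfl, le_antisymm ((measure_mono (Ici_subset_Ici.2 h)).trans hxt.le) hy⟩

-- Order the columns by height, with ties broken by `u`, and cut this order at the thresholds `x n`
-- beyond which the mass is the tail `τ n = ∑ a j` over `j ≥ n`.
open Set Filter Topology in
theorem exists_isSweeping_columns {Ω : Type*} [MeasurableSpace Ω] {μ : Measure Ω}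
    [IsProbabilityMeasure μ] {T : Ω ≃ᵐ Ω} (hT : Ergodic T μ)
    {u : Ω → unitInterval} (hu : Measurable u) (huv : μ.map u = volume)
    (L : ℕ → ℕ) {a : ℕ → ENNReal} (ha : ∀ n, a n ≠ 0) (ha1 : ∑' n, a n < 1) :
    ∃ (A : Set Ω) (h : IsSweeping T A) (D : ℕ → Set Ω), (∀ n, MeasurableSet (D n)) ∧
      Pairwise (Function.onFun Disjoint D) ∧ (∀ n, D n ⊆ A) ∧ (∀ n, ∀ ω ∈ D n, L n ≤ h.ret ω) ∧
      ∀ n, μ (h.base ⁻¹' D n) = a n := by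
  let L' : ℕ → ℕ := fun n => ∑ j ∈ Finset.range (n + 1), L j
  have hL' : Monotone L' := fun m n hmn =>
    Finset.sum_le_sum_of_subset (Finset.range_subset_range.2 (by omega))
  have hLL' (n) : L n ≤ L' n :=
    Finset.single_le_sum (f := L) (fun _ _ => Nat.zero_le _) (Finset.self_mem_range_succ n)
  let τ : ℕ → ENNReal := fun n => ∑' j, a (j + n)
  have hτ_succ (n) : τ n = a n + τ (n + 1) := by
    simp only [τ]
    rw [tsum_eq_zero_add' ENNReal.summable]
    simp [add_assoc, add_comm 1 n]
  have hτ_anti : Antitone τ := antitone_nat_of_succ_le fun n => by rw [hτ_succ n]; exact le_add_self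
  have hτ0 : τ 0 < 1 := ha1
  have hτ1 (n) : τ n < 1 := (hτ_anti (Nat.zero_le n)).trans_lt hτ0
  have hτ_pos (n) : 0 < τ n := by
    rw [hτ_succ n]
    exact (pos_iff_ne_zero.2 (ha n)).trans_le le_self_add
  have hτ_lt (n) : τ (n + 1) < τ n :=
    (ENNReal.lt_add_right (ne_top_of_lt (hτ1 (n + 1))) (ha n)).trans_eq
      ((add_comm _ _).trans (hτ_succ n).symm)
  obtain ⟨A, h, hA⟩ := exists_isSweeping_le_measure_ret hT hu huv
    (L := fun n => L' n + 1) (fun m n hmn => Nat.succ_le_succ (hL' hmn)) hτ_anti hτ0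
    (ENNReal.tendsto_sum_nat_add a (ne_top_of_lt ha1))
  -- Adding `u` removes the atoms of the height; since `u ≤ 1`, a threshold `L' n + 1` for `k` still
  -- forces height at least `L' n`.
  let k : Ω → ℝ := fun ω => h.ret ω + u ω
  have hk : Measurable k :=
    ((measurable_from_nat (f := fun n => (n : ℝ))).comp h.measurable_ret).add
      (measurable_subtype_coe.comp hu)
  have hκ : Measurable (k ∘ h.base) := hk.comp h.measurable_base
  have : IsProbabilityMeasure (μ.map (k ∘ h.base)) :=
    Measure.isProbabilityMeasure_map hκ.aemeasurable
  have : NullSingletonClass (μ.map (k ∘ h.base)) := by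
    refine ⟨fun x => ?_⟩
    rw [Measure.map_apply hκ (measurableSet_singleton x), preimage_comp]
    refine h.measure_base_preimage_null hT.toMeasurePreserving ?_
    refine measure_mono_null (t := ⋃ m : ℕ, (fun ω => (u ω : ℝ)) ⁻¹' {x - m}) (fun ω hω => ?_)
      (measure_iUnion_null fun m => measure_coe_preimage_singleton hu huv _)
    refine mem_iUnion.2 ⟨h.ret ω, ?_⟩
    simp only [mem_preimage, mem_singleton_iff, k] at hω ⊢
    linarith
  have hx (n : ℕ) := exists_le_measure_Ici_eq (μ.map (k ∘ h.base)) (hτ_pos n) (hτ1 n)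
    (y := L' n + 1) (by
      rw [Measure.map_apply hκ measurableSet_Ici]
      refine (hA n).trans (measure_mono fun ω hω => ?_)
      have h1 := (u (h.base ω)).2.1
      have h2 : ((L' n + 1 : ℕ) : ℝ) ≤ h.ret (h.base ω) := by exact_mod_cast hω
      push_cast at h2
      simp only [mem_preimage, Function.comp, mem_Ici, k]
      linarith)
  choose x hxL hxτ using hx
  have hxmono : Monotone x := by
    refine monotone_nat_of_le_succ fun n => ?_
    by_contra! hlt
    have h1 := measure_mono (μ := μ.map (k ∘ h.base)) (Ici_subset_Ici.2 hlt.le)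
    rw [hxτ, hxτ] at h1
    exact (hτ_lt n).not_ge h1
  refine ⟨A, h, fun n => A ∩ k ⁻¹' Ico (x n) (x (n + 1)),
    fun n => h.measurableSet.inter (hk measurableSet_Ico), fun m n hmn => ?_,
    fun n => inter_subset_left, fun n ω hω => ?_, fun n => ?_⟩
  · exact ((hxmono.pairwise_disjoint_on_Ico_succ hmn).preimage k).mono inter_subset_right
      inter_subset_right
  · have h1 := (u ω).2.2
    have h2 := hω.2.1
    have h3 := hxL n
    simp only [k] at h2
    have h4 : (L' n : ℝ) ≤ h.ret ω := by linarith
    exact (hLL' n).trans (by exact_mod_cast h4)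
  · have h1 : h.base ⁻¹' (A ∩ k ⁻¹' Ico (x n) (x (n + 1)))
        = (k ∘ h.base) ⁻¹' Ico (x n) (x (n + 1)) := by
      ext ω
      simp [h.base_mem ω]
    rw [h1, ← Measure.map_apply hκ measurableSet_Ico, ← Ici_sdiff_Ici,
      measure_sdiff (Ici_subset_Ici.2 (hxmono (Nat.le_succ n))) measurableSet_Ici.nullMeasurableSet
        (measure_ne_top _ _), hxτ, hxτ, hτ_succ n]
    exact ENNReal.add_sub_cancel_right (ne_top_of_lt (hτ1 _))

/-! ### Closed walks based at `0` -/

/-- The closed walk of length `k` that follows `l`, stays at its end `n` as long as possible, and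
returns. -/
def stayWord (l : List ℕ) (n k : ℕ) : List ℕ :=
  l ++ (List.replicate (k - 2 * l.length) n ++ l.reverse)

/-- The closed walk of length `k` that follows `l`, returns at once, and rests at `0`. -/
def returnWord (l : List ℕ) (k : ℕ) : List ℕ :=
  l ++ (l.reverse ++ List.replicate (k - 2 * l.length) 0)

section Words

variable {r : ℕ → ℕ → Prop} {l : List ℕ} {n k : ℕ}

theorem length_stayWord (h : 2 * l.length ≤ k) : (stayWord l n k).length = k := by
  simp [stayWord]; omega

theorem length_returnWord (h : 2 * l.length ≤ k) : (returnWord l k).length = k := by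
  simp [returnWord]; omega

theorem isChain_reverse_of_symm (hs : ∀ x y, r x y → r y x) (hl : l.IsChain r) :
    l.reverse.IsChain r :=
  List.isChain_reverse.2 (hl.imp fun x y h => hs x y h)

theorem isChain_stayWord (hr : ∀ x, r x x) (hs : ∀ x y, r x y → r y x) (hl : l.IsChain r)
    (hlast : l.getLast? = some n) : (stayWord l n k).IsChain r := by
  have hrev : l.reverse.head? = some n := by rw [List.head?_reverse, hlast]
  refine List.isChain_append.2 ⟨hl, List.isChain_append.2
    ⟨List.isChain_replicate_of_rel _ (hr n), isChain_reverse_of_symm hs hl, ?_⟩, ?_⟩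
  · intro x hx y hy
    have hx' := List.eq_of_mem_replicate (List.mem_of_getLast? hx)
    rw [hrev] at hy
    cases hy
    rw [hx']
    exact hr _
  · intro x hx y hy
    rw [hlast] at hx
    cases hx
    have : y = n := by
      rcases h : k - 2 * l.length with _ | m
      · simp only [h, List.replicate_zero, List.nil_append, hrev] at hy
        exact (Option.some.inj hy).symm
      · simp only [h, List.replicate_succ, List.cons_append, List.head?_cons] at hy
        exact (Option.some.inj hy).symm
    rw [this]
    exact hr _

theorem isChain_returnWord (hr : ∀ x, r x x) (hs : ∀ x y, r x y → r y x) (hl : l.IsChain r)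
    (hhead : l.head? = some 0) (hlast : l.getLast? = some n) : (returnWord l k).IsChain r := by
  have hrev : l.reverse.head? = some n := by rw [List.head?_reverse, hlast]
  have hrev' : l.reverse.getLast? = some 0 := by rw [List.getLast?_reverse, hhead]
  refine List.isChain_append.2 ⟨hl, List.isChain_append.2
    ⟨isChain_reverse_of_symm hs hl, List.isChain_replicate_of_rel _ (hr 0), ?_⟩, ?_⟩
  · intro x hx y hy
    have hy' := List.eq_of_mem_replicate (List.mem_of_mem_head? hy)
    rw [hrev'] at hx
    cases hx
    rw [hy']
    exact hr _
  · intro x hx y hy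
    rw [hlast] at hx
    rw [List.head?_append, hrev] at hy
    cases hx
    cases hy
    exact hr _

theorem head?_stayWord (hhead : l.head? = some 0) : (stayWord l n k).head? = some 0 := by
  rw [stayWord, List.head?_append, hhead]; rfl

theorem head?_returnWord (hhead : l.head? = some 0) : (returnWord l k).head? = some 0 := by
  rw [returnWord, List.head?_append, hhead]; rfl

theorem getLast?_stayWord (hhead : l.head? = some 0) : (stayWord l n k).getLast? = some 0 := by
  rw [stayWord, List.getLast?_append, List.getLast?_append, List.getLast?_reverse, hhead]; rfl

theorem getLast?_returnWord (hhead : l.head? = some 0) : (returnWord l k).getLast? = some 0 := by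
  rw [returnWord, List.getLast?_append, List.getLast?_append, List.getLast?_reverse, hhead,
    List.getLast?_replicate]
  split_ifs <;> rfl

theorem count_stayWord (v : ℕ) : (stayWord l n k).count v
    = 2 * l.count v + if v = n then k - 2 * l.length else 0 := by
  simp only [stayWord, List.count_append, List.count_reverse, List.count_replicate, beq_iff_eq,
    eq_comm (a := n)]
  ring

theorem count_returnWord {v : ℕ} (hv : v ≠ 0) : (returnWord l k).count v = 2 * l.count v := by
  simp only [returnWord, List.count_append, List.count_reverse, List.count_replicate, beq_iff_eq,
    hv.symm, if_false]
  ring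

end Words

/-! ### Stationary walks on a connected graph -/

namespace IsSweeping

variable {Ω : Type*} [MeasurableSpace Ω] {T : Ω ≃ᵐ Ω} {A : Set Ω}

open Set in
/-- Labelling by walks to `n` and back on the columns over `D n`, with a long stay at `n` on the
columns over `D' n`. -/
theorem exists_label_measure_eq (h : IsSweeping T A) {μ : Measure Ω} (hT : MeasurePreserving T μ μ)
    {r : ℕ → ℕ → Prop} (hr : ∀ x, r x x) (hs : ∀ x y, r x y → r y x)
    {l : ℕ → List ℕ} (hl : ∀ n, (l n).IsChain r) (hhead : ∀ n, (l n).head? = some 0)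
    (hlast : ∀ n, (l n).getLast? = some n) {D D' : ℕ → Set Ω} (hD : ∀ n, MeasurableSet (D n))
    (hD' : ∀ n, MeasurableSet (D' n)) (hdisj : Pairwise (Function.onFun Disjoint D))
    (hDA : ∀ n, D n ⊆ A) (hret : ∀ n, ∀ ω ∈ D n, 2 * (l n).length ≤ h.ret ω) :
    ∃ g : Ω → ℕ, Measurable g ∧ (∀ ω, r (g ω) (g (T ω))) ∧ ∀ v, v ≠ 0 → μ (g ⁻¹' {v}) =
      ∑' n, ((2 * (l n).count v : ℕ) : ENNReal) * μ (D n)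
        + ∫⁻ ω in D v ∩ D' v, ((h.ret ω - 2 * (l v).length : ℕ) : ENNReal) ∂μ := by
  classical
  -- Encode the piece containing `ω` by a number: `n + 1` on `D n`, and `0` off all pieces.
  have hex : ∀ ω, ∃ n, (n = 0 ∧ ∀ m, ω ∉ D m) ∨ ∃ m, n = m + 1 ∧ ω ∈ D m := by
    intro ω
    by_cases hω : ∃ m, ω ∈ D m
    · exact hω.elim fun m hm => ⟨m + 1, Or.inr ⟨m, rfl, hm⟩⟩
    · exact ⟨0, Or.inl ⟨rfl, not_exists.1 hω⟩⟩
  let κ : Ω → ℕ := fun ω => Nat.find (hex ω)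
  have hκm : Measurable κ := measurable_find hex fun n => by
    refine MeasurableSet.union (MeasurableSet.inter (MeasurableSet.const _) ?_) ?_
    · have h1 : MeasurableSet {ω | ∀ m, ω ∉ D m} := by
        simp_rw [ofPred_forall]
        exact MeasurableSet.iInter fun m => (hD m).compl
      exact h1
    · have h1 : MeasurableSet {ω | ∃ m, n = m + 1 ∧ ω ∈ D m} := by
        simp_rw [ofPred_exists]
        exact MeasurableSet.iUnion fun m => (MeasurableSet.const _).inter (hD m)
      exact h1
  have hκD {ω : Ω} {n : ℕ} (hω : ω ∈ D n) : κ ω = n + 1 := by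
    rcases Nat.find_spec (hex ω) with ⟨-, h2⟩ | ⟨m, h2, h3⟩
    · exact absurd hω (h2 n)
    · have : m = n := by
        by_contra hne
        exact disjoint_left.1 (hdisj hne) h3 hω
      rw [← this]; exact h2
  have hκ0 {ω : Ω} (hω : ∀ n, ω ∉ D n) : κ ω = 0 := by
    rcases Nat.find_spec (hex ω) with ⟨h2, -⟩ | ⟨m, h2, h3⟩
    · exact h2
    · exact absurd h3 (hω m)
  let B : Set Ω := ⋃ n, (D n ∩ D' n)
  have hB : MeasurableSet B := MeasurableSet.iUnion fun n => (hD n).inter (hD' n)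
  have hBD {ω : Ω} {n : ℕ} (hω : ω ∈ D n) : ω ∈ B ↔ ω ∈ D' n := by
    refine ⟨fun hb => ?_, fun hd => mem_iUnion.2 ⟨n, hω, hd⟩⟩
    obtain ⟨m, h3, h4⟩ := mem_iUnion.1 hb
    have : m = n := by
      by_contra hne
      exact disjoint_left.1 (hdisj hne) h3 hω
    exact this ▸ h4
  let F₁ : ℕ × ℕ → List ℕ := fun q =>
    if q.1 = 0 then List.replicate q.2 0 else stayWord (l (q.1 - 1)) (q.1 - 1) q.2
  let F₂ : ℕ × ℕ → List ℕ := fun q =>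
    if q.1 = 0 then List.replicate q.2 0 else returnWord (l (q.1 - 1)) q.2
  let W : Ω → List ℕ := fun ω => if ω ∈ B then F₁ (κ ω, h.ret ω) else F₂ (κ ω, h.ret ω)
  have hWm : Measurable[_, ⊤] W := by
    let _ : MeasurableSpace (List ℕ) := ⊤
    exact Measurable.ite hB
      ((measurable_of_countable F₁).comp (hκm.prodMk h.measurable_ret))
      ((measurable_of_countable F₂).comp (hκm.prodMk h.measurable_ret))
  have hW0 {ω : Ω} (hω : ∀ n, ω ∉ D n) : W ω = List.replicate (h.ret ω) 0 := by
    simp [W, F₁, F₂, hκ0 hω]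
  have hW1 {ω : Ω} {n : ℕ} (hω : ω ∈ D n) (hω' : ω ∈ D' n) :
      W ω = stayWord (l n) n (h.ret ω) := by
    simp [W, F₁, hκD hω, (hBD hω).2 hω']
  have hW2 {ω : Ω} {n : ℕ} (hω : ω ∈ D n) (hω' : ω ∉ D' n) :
      W ω = returnWord (l n) (h.ret ω) := by
    simp [W, F₂, hκD hω, (hBD hω).not.2 hω']
  have hcases (P : Ω → List ℕ → Prop) (h0 : ∀ ω, P ω (List.replicate (h.ret ω) 0))
      (h1 : ∀ n, ∀ ω ∈ D n, P ω (stayWord (l n) n (h.ret ω)))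
      (h2 : ∀ n, ∀ ω ∈ D n, P ω (returnWord (l n) (h.ret ω))) (ω : Ω) : P ω (W ω) := by
    by_cases hω : ∃ n, ω ∈ D n
    · obtain ⟨n, hn⟩ := hω
      by_cases hω' : ω ∈ D' n
      · rw [hW1 hn hω']; exact h1 n ω hn
      · rw [hW2 hn hω']; exact h2 n ω hn
    · rw [hW0 (not_exists.1 hω)]; exact h0 ω
  have hlen (ω) : (W ω).length = h.ret ω :=
    hcases (fun ω w => w.length = h.ret ω) (fun ω => List.length_replicate)
      (fun n ω hω => length_stayWord (hret n ω hω))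
      (fun n ω hω => length_returnWord (hret n ω hω)) ω
  refine ⟨h.label W, h.measurable_label hWm,
    h.label_rel (fun ω _ => hlen ω) (hr 0) (fun ω _ => ?_) (fun ω _ => ?_) (fun ω _ => ?_),
    fun v hv => ?_⟩
  · exact hcases (fun ω w => w.IsChain r) (fun ω => List.isChain_replicate_of_rel _ (hr 0))
      (fun n ω _ => isChain_stayWord hr hs (hl n) (hlast n))
      (fun n ω _ => isChain_returnWord hr hs (hl n) (hhead n) (hlast n)) ω
  · exact hcases (fun ω w => w.head? = some 0)
      (fun ω => by rw [List.head?_replicate, if_neg (h.ret_pos ω).ne'])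
      (fun n ω _ => head?_stayWord (hhead n)) (fun n ω _ => head?_returnWord (hhead n)) ω
  · exact hcases (fun ω w => w.getLast? = some 0)
      (fun ω => by rw [List.getLast?_replicate, if_neg (h.ret_pos ω).ne'])
      (fun n ω _ => getLast?_stayWord (hhead n)) (fun n ω _ => getLast?_returnWord (hhead n)) ω
  · rw [h.measure_label hT hWm (fun ω _ => hlen ω) v]
    have hcount (ω : Ω) : ((W ω).count v : ENNReal)
        = ∑' n, (D n).indicator (fun _ => ((2 * (l n).count v : ℕ) : ENNReal)) ω
          + (D v ∩ D' v).indicator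
              (fun ω => ((h.ret ω - 2 * (l v).length : ℕ) : ENNReal)) ω := by
      by_cases hω : ∃ n, ω ∈ D n
      · obtain ⟨n, hn⟩ := hω
        have huniq (m) (hm : m ≠ n) : ω ∉ D m := fun h' => disjoint_left.1 (hdisj hm) h' hn
        rw [tsum_eq_single n fun m hm => indicator_of_notMem (huniq m hm) _, indicator_of_mem hn]
        by_cases hω' : ω ∈ D' n
        · rw [hW1 hn hω', count_stayWord]
          by_cases hvn : v = n
          · subst hvn
            rw [indicator_of_mem (show ω ∈ D v ∩ D' v from ⟨hn, hω'⟩), if_pos rfl, Nat.cast_add]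
          · rw [indicator_of_notMem (fun h' => huniq v hvn h'.1), if_neg hvn, add_zero, add_zero]
        · rw [hW2 hn hω', count_returnWord hv, indicator_of_notMem, add_zero]
          rintro ⟨h3, h4⟩
          have : v = n := by
            by_contra hne
            exact huniq v hne h3
          exact hω' (this ▸ h4)
      · have hω := not_exists.1 hω
        rw [hW0 hω, List.count_replicate, indicator_of_notMem fun h' => hω v h'.1]
        simp [hω, hv.symm]
    simp_rw [hcount]
    have hmr : Measurable fun ω => ((h.ret ω - 2 * (l v).length : ℕ) : ENNReal) :=
      (measurable_from_nat (f := fun m => ((m - 2 * (l v).length : ℕ) : ENNReal))).comp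
        h.measurable_ret
    rw [lintegral_add_right _ (hmr.indicator ((hD v).inter (hD' v))),
      lintegral_tsum fun n => (measurable_const.indicator (hD n)).aemeasurable,
      setLIntegral_indicator ((hD v).inter (hD' v)),
      inter_eq_left.2 (inter_subset_left.trans (hDA v))]
    congr 1
    refine tsum_congr fun n => ?_
    rw [lintegral_indicator_const (hD n), Measure.restrict_apply (hD n), inter_eq_left.2 (hDA n)]

end IsSweeping

theorem ENNReal.tsum_nat_eq_zero_add_ite (q : ℕ → ENNReal) :
    ∑' n, q n = q 0 + ∑' n, if n = 0 then 0 else q n := by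
  convert ENNReal.tsum_eq_add_tsum_ite (f := q) 0

theorem exists_forall_le_nat_mul (l : List ℕ) {q : ℕ → ENNReal} (hq : ∀ v, q v ≠ 0) {b : ENNReal}
    (hb : b ≠ ⊤) : ∃ N : ℕ, ∀ v ∈ l, b ≤ N * q v := by
  choose f hf using fun v => ENNReal.exists_nat_mul_gt (hq v) hb
  refine ⟨l.toFinset.sup f, fun v hv => (hf v).le.trans ?_⟩
  gcongr
  exact Finset.le_sup (List.mem_toFinset.2 hv)

theorem exists_walk_of_reflTransGen {r : ℕ → ℕ → Prop} {n : ℕ}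
    (h : Relation.ReflTransGen r 0 n) :
    ∃ l : List ℕ, l.IsChain r ∧ l.head? = some 0 ∧ l.getLast? = some n := by
  obtain ⟨l, hl, hlast⟩ := List.exists_isChain_cons_of_relationReflTransGen h
  exact ⟨0 :: l, hl, rfl, by rw [List.getLast?_eq_getLast_of_ne_nil (by simp), hlast]⟩

open Set in
/-- An ergodic transformation of an atomless space generates, for every probability on the vertices
of a connected reflexive graph, a stationary walk with that one-dimensional distribution. -/
theorem exists_label_of_connected {Ω : Type*} [MeasurableSpace Ω] {μ : Measure Ω}
    [IsProbabilityMeasure μ] {T : Ω ≃ᵐ Ω} (hT : Ergodic T μ)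
    {u : Ω → unitInterval} (hu : Measurable u) (huv : μ.map u = volume)
    {r : ℕ → ℕ → Prop} (hr : ∀ x, r x x) (hs : ∀ x y, r x y → r y x)
    (hconn : ∀ n, Relation.ReflTransGen r 0 n) {p : ℕ → ENNReal} (hp : ∀ v, p v ≠ 0)
    (hp1 : ∑' v, p v = 1) :
    ∃ g : Ω → ℕ, Measurable g ∧ (∀ ω, r (g ω) (g (T ω))) ∧ ∀ v, μ (g ⁻¹' {v}) = p v := by
  choose l hl hhead hlast using fun n => exists_walk_of_reflTransGen (hconn n)
  obtain ⟨ε, hε0, hε⟩ := ENNReal.exists_pos_sum_of_countable (one_ne_zero (α := ENNReal)) ℕ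
  have hple (v) : p v ≤ 1 := hp1 ▸ ENNReal.le_tsum v
  have hptop (v) : p v ≠ ⊤ := ne_top_of_le_ne_top ENNReal.one_ne_top (hple v)
  have hεtop (n) : (ε n : ENNReal) ≠ ⊤ := ENNReal.coe_ne_top
  have hε1 (n) : (ε n : ENNReal) ≤ 1 := (ENNReal.le_tsum n).trans hε.le
  have hlpos (n) : 0 < (l n).length := by
    rw [List.length_pos_iff]
    rintro h
    simpa [h] using hhead n
  have hmem0 (n) : 0 ∈ l n := List.mem_of_mem_head? (hhead n)
  -- At height `L n` the travel fraction `2 * (l n).length / L n` is at most `p v * ε n` for each of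
  -- the finitely many vertices on the walk.
  choose L hL using fun n => exists_forall_le_nat_mul (l n) (q := fun v => p v * ε n)
    (fun v => mul_ne_zero (hp v) (ENNReal.coe_ne_zero.2 (hε0 n).ne'))
    (ENNReal.natCast_ne_top (2 * (l n).length))
  have hLlen (n) : 2 * (l n).length ≤ L n := by
    have h1 := (hL n 0 (hmem0 n)).trans (mul_le_mul_right (mul_le_one' (hple 0) (hε1 n)) (L n : ENNReal))
    rw [mul_one] at h1
    exact_mod_cast h1
  have hL0 (n) : (L n : ENNReal) ≠ 0 := by
    have h1 := hlpos n
    have h2 := hLlen n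
    exact Nat.cast_ne_zero.2 (by omega)
  let s : ℕ → ENNReal := fun n => (2 * (l n).length : ℕ) / L n
  have hsL (n) : s n * L n = (2 * (l n).length : ℕ) :=
    ENNReal.div_mul_cancel (hL0 n) (ENNReal.natCast_ne_top _)
  have hsp (n v) (hv : v ∈ l n) : s n ≤ p v * ε n :=
    ENNReal.div_le_of_le_mul' (hL n v hv)
  have hs0 (n) : s n ≠ 0 :=
    (ENNReal.div_pos (Nat.cast_ne_zero.2 (by have := hlpos n; omega))
      (ENNReal.natCast_ne_top _)).ne'
  have hsfin (n) : s n ≠ ⊤ :=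
    ne_top_of_le_ne_top (ENNReal.mul_ne_top (hptop 0) (hεtop n)) (hsp n 0 (hmem0 n))
  -- Columns over `D n` get mass `p n` for staying plus `s n` for travel. Vertex `0` needs no stay,
  -- and the `p 0` thus saved pays for all travel.
  let a : ℕ → ENNReal := fun n => (if n = 0 then 0 else p n) + s n
  have ha0 (n) : a n ≠ 0 := by simp [a, hs0 n]
  have hsplit : ∑' n, p n = p 0 + ∑' n, if n = 0 then 0 else p n :=
    ENNReal.tsum_nat_eq_zero_add_ite p
  have ha1 : ∑' n, a n < 1 := by
    rw [ENNReal.tsum_add, ← hp1, hsplit, add_comm]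
    have hfin : ∑' n, (if n = 0 then 0 else p n) ≠ ⊤ := by
      refine ne_top_of_le_ne_top ENNReal.one_ne_top ?_
      rw [← hp1, hsplit]
      exact le_add_self
    refine (ENNReal.add_lt_add_iff_right hfin).2 ?_
    calc ∑' n, s n ≤ ∑' n, p 0 * ε n := ENNReal.tsum_le_tsum fun n => hsp n 0 (hmem0 n)
      _ = p 0 * ∑' n, (ε n : ENNReal) := ENNReal.tsum_mul_left
      _ < p 0 * 1 := ENNReal.mul_lt_mul_right (hp 0) (hptop 0) hε
      _ = p 0 := mul_one _
  obtain ⟨A, h, D, hD, hdisj, hDA, hDret, hDa⟩ := exists_isSweeping_columns hT hu huv L ha0 ha1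
  have hMP := hT.toMeasurePreserving
  have hret (n) (ω) (hω : ω ∈ D n) : 2 * (l n).length ≤ h.ret ω :=
    (hLlen n).trans (hDret n ω hω)
  have hint (n) : ∫⁻ ω in D n, (h.ret ω : ENNReal) ∂μ = a n := by
    rw [← h.measure_base_preimage hMP (hD n) (hDA n), hDa]
  have hDs (n) : ((2 * (l n).length : ℕ) : ENNReal) * μ (D n) ≤ s n := by
    rw [← hsL, mul_assoc]
    refine mul_le_of_le_one_right' ?_
    calc (L n : ENNReal) * μ (D n) = ∫⁻ _ in D n, (L n : ENNReal) ∂μ := by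
          rw [setLIntegral_const]
      _ ≤ ∫⁻ ω in D n, (h.ret ω : ENNReal) ∂μ :=
          setLIntegral_mono' (hD n) fun ω hω => by exact_mod_cast hDret n ω hω
      _ = a n := hint n
      _ ≤ 1 := (ENNReal.le_tsum n).trans ha1.le
  -- The mass that vertex `v` receives from travel alone.
  let c : ℕ → ENNReal := fun v => ∑' n, ((2 * (l n).count v : ℕ) : ENNReal) * μ (D n)
  have hc (v) : c v ≤ p v := by
    calc c v ≤ ∑' n, p v * ε n := by
          refine ENNReal.tsum_le_tsum fun n => ?_
          by_cases hv : v ∈ l n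
          · refine le_trans ?_ ((hDs n).trans (hsp n v hv))
            gcongr
            exact List.count_le_length
          · simp [List.count_eq_zero_of_not_mem hv]
      _ = p v * ∑' n, (ε n : ENNReal) := ENNReal.tsum_mul_left
      _ ≤ p v := mul_le_of_le_one_right' hε.le
  have hstay (v) (hv : v ≠ 0) :
      p v ≤ ∫⁻ ω in D v, ((h.ret ω - 2 * (l v).length : ℕ) : ENNReal) ∂μ := by
    have h1 : a v = ∫⁻ ω in D v, ((h.ret ω - 2 * (l v).length : ℕ) : ENNReal) ∂μ
        + (2 * (l v).length : ℕ) * μ (D v) := by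
      rw [← hint, ← setLIntegral_const, ← lintegral_add_right _ measurable_const]
      refine setLIntegral_congr_fun (hD v) fun ω hω => ?_
      have h2 := hret v ω hω
      rw [← Nat.cast_add, Nat.sub_add_cancel h2]
    have h2 : p v + s v ≤ ∫⁻ ω in D v, ((h.ret ω - 2 * (l v).length : ℕ) : ENNReal) ∂μ + s v := by
      calc p v + s v = a v := by simp [a, hv]
        _ ≤ _ := by rw [h1]; gcongr; exact hDs v
    exact (ENNReal.add_le_add_iff_right (hsfin v)).1 h2
  -- Staying throughout `D v` would give at least `p v`. The measure with the staying time as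
  -- density is atomless along `u`, so some part `D'` gives exactly the deficit `p v - c v`.
  have hD' (v) : ∃ D', MeasurableSet D' ∧ (v ≠ 0 →
      ∫⁻ ω in D v ∩ D', ((h.ret ω - 2 * (l v).length : ℕ) : ENNReal) ∂μ = p v - c v) := by
    by_cases hv : v = 0
    · exact ⟨∅, MeasurableSet.empty, fun h' => absurd hv h'⟩
    let ρ := (μ.restrict (D v)).withDensity
      fun ω => ((h.ret ω - 2 * (l v).length : ℕ) : ENNReal)
    have hρuniv : ρ univ = ∫⁻ ω in D v, ((h.ret ω - 2 * (l v).length : ℕ) : ENNReal) ∂μ := by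
      rw [withDensity_apply _ MeasurableSet.univ, Measure.restrict_univ]
    have hρfin : IsFiniteMeasure ρ := by
      refine ⟨lt_of_le_of_lt ?_ ((ENNReal.le_tsum v).trans_lt (ha1.trans ENNReal.one_lt_top))⟩
      rw [hρuniv, ← hint]
      exact lintegral_mono fun ω => Nat.cast_le.2 (Nat.sub_le _ _)
    have hρu (x : ℝ) : ρ ((fun ω => (u ω : ℝ)) ⁻¹' {x}) = 0 :=
      ((withDensity_absolutelyContinuous _ _).trans Measure.absolutelyContinuous_restrict)
        (measure_coe_preimage_singleton hu huv x)
    obtain ⟨D', hD'm, hD'⟩ := exists_measurableSet_measure_eq ρ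
      (measurable_subtype_coe.comp hu) hρu (t := p v - c v)
      (tsub_le_self.trans ((hstay v hv).trans hρuniv.ge))
    refine ⟨D', hD'm, fun _ => ?_⟩
    rw [← hD', withDensity_apply _ hD'm, Measure.restrict_restrict hD'm, inter_comm]
  choose D' hD'm hD' using hD'
  obtain ⟨g, hg, hgr, hgv⟩ :=
    h.exists_label_measure_eq hMP hr hs hl hhead hlast hD hD'm hdisj hDA hret
  have hgp (v) (hv : v ≠ 0) : μ (g ⁻¹' {v}) = p v := by
    rw [hgv v hv, hD' v hv]
    exact add_tsub_cancel_of_le (hc v)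
  refine ⟨g, hg, hgr, fun v => ?_⟩
  by_cases hv : v = 0
  -- Both distributions have total mass `1` and agree off `0`, hence at `0`.
  · have h1 : ∑' v, μ (g ⁻¹' {v}) = 1 := by
      rw [← measure_iUnion (fun i j hij => Disjoint.preimage _ (disjoint_singleton.2 hij))
        fun v => hg (measurableSet_singleton v), ← preimage_iUnion, iUnion_of_singleton,
        preimage_univ, measure_univ]
    have h2 : ∑' v, (if v = 0 then 0 else μ (g ⁻¹' {v})) = ∑' v, if v = 0 then 0 else p v :=
      tsum_congr fun v => by
        split_ifs with h'
        · rfl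
        · exact hgp v h'
    rw [ENNReal.tsum_nat_eq_zero_add_ite, h2, ← hp1, hsplit] at h1
    have hfin : ∑' n, (if n = 0 then 0 else p n) ≠ ⊤ := by
      refine ne_top_of_le_ne_top ENNReal.one_ne_top ?_
      rw [← hp1, hsplit]
      exact le_add_self
    rw [hv]
    exact (ENNReal.add_left_inj hfin).1 h1
  · exact hgp v hv

/-! ### Decomposing the target measure along a connected cover -/

-- Use the densities `e v / Z`, a measurable partition of unity with summable weights `ε v` on `O
-- v`. As `Z ≤ 1`, the density is at least `ε v` on `O v`, so every piece has positive mass even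
-- where the sets overlap.
open Set in
theorem exists_sum_eq_of_cover {X : Type*} [MeasurableSpace X] (η : Measure X)
    {O : ℕ → Set X} (hO : ∀ v, MeasurableSet (O v)) (hcov : η (⋃ v, O v)ᶜ = 0)
    (h0 : ∀ v, η (O v) ≠ 0) :
    ∃ ν : ℕ → Measure X, Measure.sum ν = η ∧ (∀ v, ν v (O v)ᶜ = 0) ∧ ∀ v, ν v univ ≠ 0 := by
  obtain ⟨ε, hε0, hε⟩ := ENNReal.exists_pos_sum_of_countable (one_ne_zero (α := ENNReal)) ℕ
  let e : ℕ → X → ENNReal := fun v => (O v).indicator fun _ => (ε v : ENNReal)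
  let Z : X → ENNReal := fun x => ∑' v, e v x
  have he (v) : Measurable (e v) := measurable_const.indicator (hO v)
  have hZ : Measurable Z := Measurable.tsum he
  have hZ1 (x) : Z x ≤ 1 :=
    (ENNReal.tsum_le_tsum fun v => indicator_le_self _ _ x).trans hε.le
  have hf (v) : Measurable fun x => e v x / Z x := (he v).div hZ
  refine ⟨fun v => η.withDensity fun x => e v x / Z x, ?_, fun v => ?_, fun v => ?_⟩
  · rw [← withDensity_tsum hf]
    have : (∑' v, fun x => e v x / Z x) =ᵐ[η] 1 := by
      filter_upwards [measure_eq_zero_iff_ae_notMem.1 hcov] with x hx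
      rw [notMem_compl_iff, mem_iUnion] at hx
      obtain ⟨v, hv⟩ := hx
      have hpos : Z x ≠ 0 := by
        intro h
        have h1 := ENNReal.tsum_eq_zero.1 h v
        simp only [e, indicator_of_mem hv, ENNReal.coe_eq_zero] at h1
        exact (hε0 v).ne' h1
      rw [ENNReal.tsum_apply]
      simp_rw [div_eq_mul_inv]
      rw [ENNReal.tsum_mul_right]
      exact ENNReal.mul_inv_cancel hpos (ne_top_of_le_ne_top ENNReal.one_ne_top (hZ1 x))
    rw [withDensity_congr_ae this, withDensity_one]
  · rw [withDensity_apply _ (hO v).compl]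
    rw [setLIntegral_congr_fun (g := 0) (hO v).compl fun x hx => by
      simp [e, indicator_of_notMem hx]]
    simp
  · rw [withDensity_apply _ MeasurableSet.univ, Measure.restrict_univ]
    have h1 : ∫⁻ x, e v x ∂η ≤ ∫⁻ x, e v x / Z x ∂η := by
      refine lintegral_mono fun x => ?_
      rw [div_eq_mul_inv]
      exact le_mul_of_one_le_right' (ENNReal.one_le_inv.2 (hZ1 x))
    rw [lintegral_indicator_const (hO v)] at h1
    refine (lt_of_lt_of_le ?_ h1).ne'
    exact pos_iff_ne_zero.2 (mul_ne_zero (ENNReal.coe_ne_zero.2 (hε0 v).ne') (h0 v))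

open Set TopologicalSpace in
/-- A budget produces a countable cover, up to a null set, by open sets of positive measure whose
adjacency graph is connected. -/
theorem FitsBudget.exists_connected_cover {X : Type*} [TopologicalSpace X]
    [SecondCountableTopology X] [MeasurableSpace X] [BorelSpace X] {η : Measure X}
    [IsProbabilityMeasure η] {c : X × X → ℝ} (hc : IsCostFunction c) {b : ℝ} (hb : 0 < b)
    (hfit : FitsBudget c η b) :
    ∃ O : ℕ → Set X, (∀ v, IsOpen (O v)) ∧ (∀ v, η (O v) ≠ 0) ∧ η (⋃ v, O v)ᶜ = 0 ∧
      (∀ v, O v ×ˢ O v ⊆ {q | c q < b}) ∧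
      ∀ n, Relation.ReflTransGen (fun v w => O v ×ˢ O w ⊆ {q | c q < b}) 0 n := by
  have hU : IsOpen {q | c q < b} := hc.upperSemicontinuous.isOpen_preimage b
  have hbasis := isBasis_countableBasis X
  have hBc := countable_countableBasis X
  -- All admissible basic sets are kept, so smaller admissible neighbourhoods are again vertices of
  -- the graph.
  let 𝒱 : Set (Set X) := {V | V ∈ countableBasis X ∧ V ×ˢ V ⊆ {q | c q < b} ∧ η V ≠ 0}
  let S : Set X := (⋃₀ {V | V ∈ countableBasis X ∧ η V = 0})ᶜ
  have hSc : {V | V ∈ countableBasis X ∧ η V = 0}.Countable := hBc.mono fun V hV => hV.1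
  have hS0 : η Sᶜ = 0 := by
    rw [compl_compl]
    exact (measure_sUnion_null_iff hSc).2 fun V hV => hV.2
  have hSm : MeasurableSet S :=
    (MeasurableSet.sUnion hSc fun V hV => (hbasis.isOpen hV.1).measurableSet).compl
  have hSpos {x : X} (hx : x ∈ S) {V : Set X} (hV : V ∈ countableBasis X) (hxV : x ∈ V) :
      η V ≠ 0 := fun h => hx ⟨V, ⟨hV, h⟩, hxV⟩
  have hprod {x y : X} (hxy : c (x, y) < b) {P Q : Set X} (hP : IsOpen P) (hQ : IsOpen Q)
      (hx : x ∈ P) (hy : y ∈ Q) : ∃ V ∈ countableBasis X, ∃ W ∈ countableBasis X,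
        x ∈ V ∧ y ∈ W ∧ V ⊆ P ∧ W ⊆ Q ∧ V ×ˢ W ⊆ {q | c q < b} := by
    obtain ⟨P', Q', hP', hQ', hx', hy', hsub⟩ := isOpen_prod_iff.1 hU x y hxy
    obtain ⟨V, hV, hxV, hVs⟩ := hbasis.exists_subset_of_mem_open
      (show x ∈ P ∩ P' from ⟨hx, hx'⟩) (hP.inter hP')
    obtain ⟨W, hW, hyW, hWs⟩ := hbasis.exists_subset_of_mem_open
      (show y ∈ Q ∩ Q' from ⟨hy, hy'⟩) (hQ.inter hQ')
    exact ⟨V, hV, W, hW, hxV, hyW, hVs.trans inter_subset_left, hWs.trans inter_subset_left,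
      (prod_mono (hVs.trans inter_subset_right) (hWs.trans inter_subset_right)).trans hsub⟩
  have hScov {x : X} (hx : x ∈ S) : ∃ V ∈ 𝒱, x ∈ V := by
    obtain ⟨P', Q', hP', hQ', hx', hy', hsub⟩ :=
      isOpen_prod_iff.1 hU x x (show c (x, x) < b by rwa [hc.diag])
    obtain ⟨V, hV, hxV, hVs⟩ := hbasis.exists_subset_of_mem_open
      (show x ∈ P' ∩ Q' from ⟨hx', hy'⟩) (hP'.inter hQ')
    exact ⟨V, ⟨hV, (prod_mono (hVs.trans inter_subset_left)
      (hVs.trans inter_subset_right)).trans hsub, hSpos hx hV hxV⟩, hxV⟩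
  have hSne : S.Nonempty := by
    rw [nonempty_iff_ne_empty]
    rintro h
    simp [h] at hS0
  obtain ⟨O, hO⟩ := (hBc.mono fun V (hV : V ∈ 𝒱) => hV.1).exists_eq_range
    (hSne.elim fun x hx => (hScov hx).imp fun V hV => hV.1)
  have hmem (v) : O v ∈ 𝒱 := hO ▸ mem_range_self v
  have hSO : S ⊆ ⋃ v, O v := by
    intro x hx
    obtain ⟨V, hV, hxV⟩ := hScov hx
    rw [hO] at hV
    obtain ⟨v, rfl⟩ := hV
    exact mem_iUnion.2 ⟨v, hxV⟩
  have hopen (v) : IsOpen (O v) := hbasis.isOpen (hmem v).1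
  refine ⟨O, hopen, fun v => (hmem v).2.2, measure_mono_null (compl_subset_compl.2 hSO) hS0,
    fun v => (hmem v).2.1, ?_⟩
  set r : ℕ → ℕ → Prop := fun v w => O v ×ˢ O w ⊆ {q | c q < b} with hr
  by_contra! hn
  obtain ⟨n, hn⟩ := hn
  -- Separate the component of `0` from the rest. Restricting to `S` ensures that every basic
  -- neighbourhood of a point found below has positive measure.
  let side : (ℕ → Prop) → Set X := fun P => (⋃ v ∈ {v | P v}, O v) ∩ S
  have hside (P) : MeasurableSet (side P) :=
    (MeasurableSet.biUnion (to_countable _) fun v _ => (hopen v).measurableSet).inter hSm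
  have hpos (P : ℕ → Prop) (v) (hv : P v) : 0 < η (side P) := by
    rw [measure_inter_conull hS0]
    exact (pos_iff_ne_zero.2 (hmem v).2.2).trans_le
      (measure_mono (subset_biUnion_of_mem (u := O) (show v ∈ {v | P v} from hv)))
  let C : ℕ → Prop := Relation.ReflTransGen r 0
  have hunion : η (side C ∪ side fun v => ¬ C v) = 1 := by
    refine le_antisymm prob_le_one ?_
    rw [← (prob_compl_eq_zero_iff hSm).1 hS0]
    refine measure_mono fun x hx => ?_
    obtain ⟨v, hv⟩ := mem_iUnion.1 (hSO hx)
    by_cases hC : C v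
    · exact Or.inl ⟨mem_biUnion (show v ∈ {v | C v} from hC) hv, hx⟩
    · exact Or.inr ⟨mem_biUnion (show v ∈ {v | ¬ C v} from hC) hv, hx⟩
  have hAp := hpos C 0 Relation.ReflTransGen.refl
  have hBp := hpos (fun v => ¬ C v) n hn
  have hinf := hfit _ _ (hside C) (hside fun v => ¬ C v) hAp hBp hunion
  obtain ⟨_, ⟨⟨x, y⟩, ⟨hx, hy⟩, rfl⟩, hxy⟩ := exists_lt_of_csInf_lt
    (((nonempty_of_measure_ne_zero hAp.ne').prod (nonempty_of_measure_ne_zero hBp.ne')).image c)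
    hinf
  obtain ⟨v, hv, hxv⟩ := mem_iUnion₂.1 hx.1
  obtain ⟨w, hw, hyw⟩ := mem_iUnion₂.1 hy.1
  -- Shrink around `x` and `y` to vertices `V ⊆ O v` and `W ⊆ O w` joined by an edge; the path `v`,
  -- `V`, `W`, `w` contradicts the separation.
  obtain ⟨V, hV, W, hW, hxV, hyW, hVv, hWw, hVW⟩ := hprod hxy (hopen v) (hopen w) hxv hyw
  have hV' : V ∈ 𝒱 := ⟨hV, (prod_mono hVv hVv).trans (hmem v).2.1, hSpos hx.2 hV hxV⟩
  have hW' : W ∈ 𝒱 := ⟨hW, (prod_mono hWw hWw).trans (hmem w).2.1, hSpos hy.2 hW hyW⟩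
  rw [hO] at hV' hW'
  obtain ⟨i, rfl⟩ := hV'
  obtain ⟨j, rfl⟩ := hW'
  have h1 : r v i := (prod_mono subset_rfl hVv).trans (hmem v).2.1
  have h2 : r j w := (prod_mono hWw subset_rfl).trans (hmem w).2.1
  exact hw (((Relation.ReflTransGen.tail hv h1).tail hVW).tail h2)

/-! ### Assembling the map -/

open Set in
theorem theoremt
    {Ω : Type*} [MeasurableSpace Ω] (μ : Measure Ω) [IsProbabilityMeasure μ]
    (hμ : IsNonatomicLebesgueSpace μ)
    (T : Ω ≃ᵐ Ω) (hT : Ergodic T μ)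
    {X : Type*} [TopologicalSpace X] [PolishSpace X] [MeasurableSpace X] [BorelSpace X]
    (η : Measure X) [IsProbabilityMeasure η]
    (c : X × X → ℝ) (hc : IsSymmetricCostFunction c)
    (b : ℝ) (hb : 0 < b) (hfit : FitsBudget c η b) :
    ∃ f : Ω → X, Measurable f ∧ Measure.map f μ = η ∧ ∀ ω, c (f ω, f (T ω)) < b := by
  classical
  obtain ⟨u, hu, huv⟩ := hμ.exists_uniform
  obtain ⟨O, hOo, hO0, hOcov, hOO, hconn⟩ := hfit.exists_connected_cover hc.toIsCostFunction hb
  obtain ⟨ν, hν, hνO, hν0⟩ := exists_sum_eq_of_cover η (fun v => (hOo v).measurableSet) hOcov hO0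
  have hν1 : ∑' v, ν v univ = 1 := by
    rw [← Measure.sum_apply _ MeasurableSet.univ, hν, measure_univ]
  obtain ⟨g, hg, hgr, hgv⟩ := exists_label_of_connected hT hu huv
    (r := fun v w => O v ×ˢ O w ⊆ {q | c q < b}) hOO
    (fun v w h q hq => by
      have := h (show (q.2, q.1) ∈ O v ×ˢ O w from ⟨hq.2, hq.1⟩)
      rw [mem_ofPred_eq, hc.symm] at this
      exact this) hconn hν0 hν1
  have : Nonempty X := η.nonempty_of_neZero
  have hF (v) := exists_measurable_map_eq_of_noAtoms (μ.restrict (g ⁻¹' {v}))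
    (measurable_subtype_coe.comp hu)
    (fun x => Measure.absolutelyContinuous_restrict (measure_coe_preimage_singleton hu huv x))
    (ν v) (by rw [Measure.restrict_apply_univ, hgv])
  choose F hF hFν using hF
  choose x hx using fun v => nonempty_of_measure_ne_zero (hO0 v)
  -- `F v` lies in `O v` only almost surely on the fibre; the default `x v` in `O v` makes this hold
  -- everywhere without changing the law.
  let G : ℕ → Ω → X := fun v ω => if F v ω ∈ O v then F v ω else x v
  have hG (v) : Measurable (G v) :=
    Measurable.ite (hF v (hOo v).measurableSet) (hF v) measurable_const
  have hGO (v ω) : G v ω ∈ O v := by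
    by_cases h : F v ω ∈ O v
    · simp [G, h]
    · simp [G, h, hx v]
  have hGν (v) : (μ.restrict (g ⁻¹' {v})).map (G v) = ν v := by
    rw [← hFν v]
    refine Measure.map_congr ?_
    have h1 := hνO v
    rw [← hFν v, Measure.map_apply (hF v) (hOo v).measurableSet.compl] at h1
    filter_upwards [measure_eq_zero_iff_ae_notMem.1 h1] with ω hω
    exact if_pos (not_not.1 hω)
  have hf : Measurable fun ω => G (g ω) ω :=
    (measurable_from_prod_countable_right (f := fun q : ℕ × Ω => G q.1 q.2) hG).comp
      (hg.prodMk measurable_id)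
  refine ⟨fun ω => G (g ω) ω, hf, ?_, fun ω => ?_⟩
  · ext B hB
    rw [Measure.map_apply hf hB, ← hν, Measure.sum_apply _ hB]
    have h1 : (fun ω => G (g ω) ω) ⁻¹' B = ⋃ v, (G v ⁻¹' B ∩ g ⁻¹' {v}) := by
      ext ω
      simp
    rw [h1, measure_iUnion]
    · refine tsum_congr fun v => ?_
      rw [← hGν v, Measure.map_apply (hG v) hB, Measure.restrict_apply (hG v hB)]
    · exact fun i j hij => (Disjoint.preimage g (disjoint_singleton.2 hij)).mono
        inter_subset_right inter_subset_right
    · exact fun v => (hG v hB).inter (hg (measurableSet_singleton v))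
  · exact hgr ω (show (G (g ω) ω, G (g (T ω)) (T ω)) ∈ O (g ω) ×ˢ O (g (T ω)) from
      ⟨hGO _ _, hGO _ _⟩)
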